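/- **Setting.** Let $L\ge 2$, let $p$ be a real nome with $0<|p|<1$, let $\lambda=\frac{\pi}{4}\frac{L+2}{L+1}$ or $\lambda=\frac{\pi}{4}\frac{L}{L+1}$, and assume $\sin 3\lambda\neq 0$ (this excludes only $L=2$, $\lambda=\pi/3$). Put $$\vartheta_1(u)=2p^{1/4}\sin u\prod_{n\ge1}(1-2p^{2n}\cos 2u+p^{4n})(1-p^{2n}),\qquad \vartheta_4(u)=\prod_{n\ge1}(1-2p^{2n-1}\cos 2u+p^{4n-2})(1-p^{2n}),$$ $$S(a)=(-1)^a\,\vartheta_1(4a\lambda)/\vartheta_4(2a\lambda).$$ Spins take values in $\{1,\dots,L\}$. Let $A_{a,b}=1$ if $|a-b|=1$ and $0$ otherwise, $A^{(0)}=I$, $A^{(1)}=I+A$, $A^{(n)}A^{(1)}=A^{(n-1)}+A^{(n+1)}$, and let $v_a=\sum_b(\delta_{a,b}+A_{a,b})$ be the valence of $a$. Spins $a,b$ are adjacent if $A^{(1)}_{a,b}\ne0$. The face weight $W(a,b,c,d\,|\,u)$, with corners $a,b,c,d$ listed anticlockwise from the bottom left, vanishes unless $a,b$; $b,c$; $c,d$;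 $d,a$ are adjacent, and otherwise $$W(a,a,a,a|u)=\tfrac{\vartheta_1(6\lambda-u)\vartheta_1(3\lambda+u)}{\vartheta_1(6\lambda)\vartheta_1(3\lambda)}-\Big(\tfrac{S(a+1)}{S(a)}\tfrac{\vartheta_4(2a\lambda-5\lambda)}{\vartheta_4(2a\lambda+\lambda)}+\tfrac{S(a-1)}{S(a)}\tfrac{\vartheta_4(2a\lambda+5\lambda)}{\vartheta_4(2a\lambda-\lambda)}\Big)\tfrac{\vartheta_1(u)\vartheta_1(3\lambda-u)}{\vartheta_1(6\lambda)\vartheta_1(3\lambda)},$$ $$W(a,a\pm1,a\pm1,a|u)=W(a,a,a\pm1,a\pm1|u)=\tfrac{\vartheta_1(u)\vartheta_1(3\lambda-u)}{\vartheta_1(2\lambda)\vartheta_1(3\lambda)}\Big(\tfrac{\vartheta_4(\pm2a\lambda+3\lambda)\vartheta_4(\pm2a\lambda-\lambda)}{\vartheta_4^2(\pm2a\lambda+\lambda)}\Big)^{1/2},$$ $$W(a,a,a,a\pm1|u)=W(a,a\pm1,a,a|u)=\tfrac{\vartheta_1(3\lambda-u)\vartheta_4(\pm2a\lambda+\lambda-u)}{\vartheta_1(3\lambda)\vartheta_4(\pm2a\lambda+\lambda)},$$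 $$W(a\pm1,a,a,a|u)=W(a,a,a\pm1,a|u)=\Big(\tfrac{S(a\pm1)}{S(a)}\Big)^{1/2}\tfrac{\vartheta_1(u)\vartheta_4(\pm2a\lambda-2\lambda+u)}{\vartheta_1(3\lambda)\vartheta_4(\pm2a\lambda+\lambda)},$$ $$W(a,a\pm1,a,a\mp1|u)=\tfrac{\vartheta_1(2\lambda-u)\vartheta_1(3\lambda-u)}{\vartheta_1(2\lambda)\vartheta_1(3\lambda)},$$ $$W(a\pm1,a,a\mp1,a|u)=-\Big(\tfrac{S(a-1)S(a+1)}{S^2(a)}\Big)^{1/2}\tfrac{\vartheta_1(u)\vartheta_1(\lambda-u)}{\vartheta_1(2\lambda)\vartheta_1(3\lambda)},$$ $$W(a\pm1,a,a\pm1,a|u)=\tfrac{\vartheta_1(3\lambda-u)\vartheta_1(\pm4a\lambda+2\lambda+u)}{\vartheta_1(3\lambda)\vartheta_1(\pm4a\lambda+2\lambda)}+\tfrac{S(a\pm1)}{S(a)}\tfrac{\vartheta_1(u)\vartheta_1(\pm4a\lambda-\lambda+u)}{\vartheta_1(3\lambda)\vartheta_1(\pm4a\lambda+2\lambda)},$$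 with $u\in\mathbb C$ and principal square roots. If the denominator $\vartheta_1(6\lambda)$ of the first weight or $\vartheta_1(\pm4a\lambda+2\lambda)$ of the last weight vanishes, that weight means the limit of its formula as the crossing parameter tends to $\lambda$ with $u$ fixed. **Fused weights.** The edge $(a,b)$ is admissible at level two if $A^{(2)}_{a,b}\neq0$, and then carries the bond variables $\alpha=1,\dots,A^{(2)}_{a,b}$. For admissible $(a,b)$ and $(d,c)$, a bond variable $\alpha$ of $(a,b)$, and an upper path $d,c',c$ with $c'$ adjacent to $d$ and $c$, and $c'\neq c$ if $c=d$ has valence $3$, define $$W_{1\times2}\big(a,b,c,d;\alpha,\beta(c')\,|\,u\big)=\sum_{a'}\phi^\alpha(a,a',b)\,W(a,a',c',d\,|\,u)\,W(a',b,c,c'\,|\,u+3\lambda),$$ $$\phi^\alpha(a,a',b)=\begin{cases}(-1)^{a+1-a'}\theta(a'-a)\big(S(a+1)/S(a')\big)^{1/2}& a=b,\ \alpha=1,\ v_a=3\\(-1)^{a-1-a'}\theta(a-a')\big(S(a-1)/S(a')\big)^{1/2}& a=b,\ \alpha=2,\ v_a=3\\(-1)^{a-a'}\big(S(a)/S(a')\big)^{1/2}&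 a=b,\ v_a=2\\\delta_{a',a+\alpha-1}& a=b-1\\\delta_{a',b+\alpha-1}& a=b+1\\\delta_{a',(a+b)/2}\,\delta_{\alpha,1}& |a-b|=2\end{cases}$$ where $\theta(x)=1$ for $x\ge0$ and $0$ for $x<0$. (When $c=d$ has valence $2$, both possible $c'$ carry the label $1$, and the definition is made for each of them.) **Lemma (elementary fusion).** (0) These objects are well defined: $\vartheta_1(2\lambda),\vartheta_1(3\lambda)\ne0$; $\vartheta_4>0$ on $\mathbb R$; $S(a)\neq0$ and $S(a)/S(b)>0$ for all spins $a,b$; and the limits used to define the exceptional weights exist. Every valence is $2$ or $3$. The edge $(a,b)$ is admissible iff $|a-b|\le2$; its bond variable is only $1$ if $|a-b|=2$, or $a=b$ with $v_a=2$; its bond variables are $1$ and $2$ if $|a-b|=1$, or $a=b$ with $v_a=3$. (i) For every upper path $d,c',c$ as above, there is exactly one bond variable $\beta$ of $(d,c)$ with $\phi^\beta(d,c',c)\ne0$, namely $$\beta(c')=\begin{cases}2&\text{if }c'=c-1=d-1\text{ and }v_c=3\\2&\text{if }c'=\max(c,d)\text{ and }|c-d|=1\\1&\text{otherwise.}\end{cases}$$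 Every bond variable of $(d,c)$ is $\beta(c')$ for some such $c'$, and for only one unless $c=d$ has valence $2$. (ii) For all $a,b,c,d$ with $(a,b)$, $(d,c)$ admissible, every bond variable $\alpha$ of $(a,b)$ and every upper path $d,c',c$ as above, $$W_{1\times2}\big(a,b,c,d;\alpha,\beta(c')\,|\,0\big)=0.$$ -/

import Mathlib

open Filter Topology

noncomputable section

namespace DiluteA

/-! ### The adjacency graph and its level-`n` fusion -/

/-- The nodes `1, …, L` of the Dynkin diagram `A_L`. -/
abbrev Site (L : ℕ) : Type := Set.Icc (1 : ℤ) (L : ℤ)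

/-- The adjacency matrix of the classical `A_L` Dynkin diagram (without loops). -/
def dynkin (L : ℕ) : Matrix (Site L) (Site L) ℤ :=
  Matrix.of fun a b => if |(a : ℤ) - (b : ℤ)| = 1 then 1 else 0

/-- The fused adjacency matrices: `A⁽⁰⁾ = I`, `A⁽¹⁾ = I + A`, and
`A⁽ⁿ⁾ A⁽¹⁾ = A⁽ⁿ⁻¹⁾ + A⁽ⁿ⁺¹⁾`. -/
def fusedAdj (L : ℕ) : ℕ → Matrix (Site L) (Site L) ℤ
  | 0 => 1
  | 1 => 1 + dynkin L
  | n + 2 => fusedAdj L (n + 1) * (1 + dynkin L) - fusedAdj L n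

/-- Two neighbouring spins are allowed when they are joined in the graph `A_L` with a loop
at each node. -/
def Adjacent (L : ℕ) (a b : Site L) : Prop := fusedAdj L 1 a b ≠ 0

/-- The valence of a node (the loop is counted once). -/
def valence (L : ℕ) (a : Site L) : ℤ :=
  ∑ b : Site L, ((if a = b then 1 else 0) + dynkin L a b)

/-- The bond variables carried by the level-two edge `(a, b)`; the edge is admissible when
`A⁽²⁾ a b ≠ 0`, and it then carries the bond variables `1, …, A⁽²⁾ a b`. -/
def bonds (L : ℕ) (a b : Site L) : Finset ℤ := Finset.Icc 1 (fusedAdj L 2 a b)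

/-! ### Theta functions of nome `p` -/

def theta1 (p : ℝ) (u : ℂ) : ℂ :=
  2 * (p : ℂ) ^ (1 / 4 : ℂ) * Complex.sin u *
    ∏' n : ℕ, ((1 - 2 * (p : ℂ) ^ (2 * (n + 1)) * Complex.cos (2 * u) + (p : ℂ) ^ (4 * (n + 1))) *
      (1 - (p : ℂ) ^ (2 * (n + 1))))

def theta4 (p : ℝ) (u : ℂ) : ℂ :=
  ∏' n : ℕ, ((1 - 2 * (p : ℂ) ^ (2 * n + 1) * Complex.cos (2 * u) + (p : ℂ) ^ (4 * n + 2)) *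
      (1 - (p : ℂ) ^ (2 * (n + 1))))

/-- `S(a) = (-1)^a θ₁(4aλ) / θ₄(2aλ)`. -/
def S (p l : ℝ) (a : ℤ) : ℂ :=
  (-1 : ℂ) ^ a * theta1 p (4 * a * l) / theta4 p (2 * a * l)

/-- The (principal) square root. -/
def root (z : ℂ) : ℂ := z ^ (1 / 2 : ℂ)

/-! ### The face weights

In `rawWeight p l a b c d u` the four corners of the face are, anticlockwise, `a` (bottom left),
`b` (bottom right), `c` (top right), `d` (top left).  In each branch the sign `±` of the
usual formulas is the integer `s = ±1`. -/

open Classical in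
/-- The explicit formulas, with the crossing parameter `l` arbitrary. -/
def rawWeight (p l : ℝ) (a b c d : ℤ) (u : ℂ) : ℂ :=
  let t1 := theta1 p
  let t4 := theta4 p
  let S := S p l
  if a = b ∧ b = c ∧ c = d then
    t1 (6 * l - u) * t1 (3 * l + u) / (t1 (6 * l) * t1 (3 * l)) -
      (S (a + 1) / S a * (t4 (2 * a * l - 5 * l) / t4 (2 * a * l + l)) +
        S (a - 1) / S a * (t4 (2 * a * l + 5 * l) / t4 (2 * a * l - l))) *
      (t1 u * t1 (3 * l - u) / (t1 (6 * l) * t1 (3 * l)))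
  else if (d = a ∧ b = c ∧ |c - a| = 1) ∨ (a = b ∧ c = d ∧ |c - a| = 1) then
    let s : ℤ := c - a
    t1 u * t1 (3 * l - u) / (t1 (2 * l) * t1 (3 * l)) *
      root (t4 (s * 2 * a * l + 3 * l) * t4 (s * 2 * a * l - l) / t4 (s * 2 * a * l + l) ^ 2)
  else if (a = b ∧ b = c ∧ |d - a| = 1) ∨ (a = c ∧ c = d ∧ |b - a| = 1) then
    let s : ℤ := if a = b then d - a else b - a
    t1 (3 * l - u) * t4 (s * 2 * a * l + l - u) / (t1 (3 * l) * t4 (s * 2 * a * l + l))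
  else if (b = c ∧ c = d ∧ |a - b| = 1) ∨ (a = b ∧ b = d ∧ |c - b| = 1) then
    let s : ℤ := if b = c then a - b else c - b
    root (S (b + s) / S b) *
      (t1 u * t4 (s * 2 * b * l - 2 * l + u) / (t1 (3 * l) * t4 (s * 2 * b * l + l)))
  else if a = c ∧ |b - a| = 1 ∧ d - a = -(b - a) then
    t1 (2 * l - u) * t1 (3 * l - u) / (t1 (2 * l) * t1 (3 * l))
  else if b = d ∧ |a - b| = 1 ∧ c - b = -(a - b) then
    -root (S (b - 1) * S (b + 1) / S b ^ 2) *
      (t1 u * t1 (l - u) / (t1 (2 * l) * t1 (3 * l)))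
  else if b = d ∧ a = c ∧ |a - b| = 1 then
    let s : ℤ := a - b
    t1 (3 * l - u) * t1 (s * 4 * b * l + 2 * l + u) / (t1 (3 * l) * t1 (s * 4 * b * l + 2 * l)) +
      S (b + s) / S b *
        (t1 u * t1 (s * 4 * b * l - l + u) / (t1 (3 * l) * t1 (s * 4 * b * l + 2 * l)))
  else 0

/-- The faces at which the explicit formula has the form `0 / 0`: the denominator `θ₁(6λ)` of
the weight with four equal spins vanishes (this happens for `L = 2`), or the denominator
`θ₁(±4bλ + 2λ)` of the weight with corners `b ± 1, b, b ± 1, b` vanishes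
(this happens for even `L`, at the middle of the diagram). -/
def Exceptional (p l : ℝ) (a b c d : ℤ) : Prop :=
  (a = b ∧ b = c ∧ c = d ∧ theta1 p (6 * l) = 0) ∨
  (b = d ∧ a = c ∧ |a - b| = 1 ∧ theta1 p ((a - b) * 4 * b * l + 2 * l) = 0)

open Classical in
/-- The face weights of the dilute `A_L` model: zero unless neighbouring corners are adjacent, and
otherwise given by the explicit formulas, a removable singularity being filled in by continuity
in the crossing parameter. -/
def faceWeight (L : ℕ) (p lam : ℝ) (a b c d : Site L) (u : ℂ) : ℂ :=
  if Adjacent L a b ∧ Adjacent L b c ∧ Adjacent L c d ∧ Adjacent L d a then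
    if Exceptional p lam a b c d then
      limUnder (𝓝[≠] lam) (fun l : ℝ => rawWeight p l a b c d u)
    else rawWeight p lam a b c d u
  else 0

/-! ### The symmetric `1 × 2` fusion -/

open Classical in
/-- The coefficients `φ^α(a, a', b)`. -/
def phi (L : ℕ) (p lam : ℝ) (α : ℤ) (a a' b : Site L) : ℂ :=
  if a = b ∧ α = 1 ∧ valence L a = 3 then
    (-1 : ℂ) ^ ((a : ℤ) + 1 - a') * (if 0 ≤ (a' : ℤ) - a then 1 else 0) *
      root (S p lam (a + 1) / S p lam a')
  else if a = b ∧ α = 2 ∧ valence L a = 3 then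
    (-1 : ℂ) ^ ((a : ℤ) - 1 - a') * (if 0 ≤ (a : ℤ) - a' then 1 else 0) *
      root (S p lam (a - 1) / S p lam a')
  else if a = b ∧ valence L a = 2 then
    (-1 : ℂ) ^ ((a : ℤ) - a') * root (S p lam a / S p lam a')
  else if (a : ℤ) = b - 1 then
    if (a' : ℤ) = a + α - 1 then 1 else 0
  else if (a : ℤ) = b + 1 then
    if (a' : ℤ) = b + α - 1 then 1 else 0
  else if |(a : ℤ) - b| = 2 then
    if 2 * (a' : ℤ) = a + b ∧ α = 1 then 1 else 0
  else 0

/-- The fused weight with corners `a, b, c, d`, lower bond variable `α`, and the spin `c'` in the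
middle of the upper edge; its upper bond variable is `bondLabel L d c' c`. -/
def fusedWeight (L : ℕ) (p lam : ℝ) (a b c d : Site L) (α : ℤ) (c' : Site L) (u : ℂ) : ℂ :=
  ∑ a' : Site L, phi L p lam α a a' b *
    faceWeight L p lam a a' c' d u * faceWeight L p lam a' b c c' (u + 3 * lam)

/-- The allowed upper paths `d, c', c`: both steps are allowed, and `c' ≠ c` when `c = d` has
valence three. -/
def UpperPath (L : ℕ) (d c' c : Site L) : Prop :=
  Adjacent L d c' ∧ Adjacent L c' c ∧ (c = d → valence L c = 3 → c' ≠ c)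

open Classical in
/-- The bond label `β(c')` of the upper path `d, c', c`. -/
def bondLabel (L : ℕ) (d c' c : Site L) : ℤ :=
  if (c' : ℤ) = c - 1 ∧ c = d ∧ valence L c = 3 then 2
  else if (c' : ℤ) = max (c : ℤ) d ∧ |(c : ℤ) - d| = 1 then 2
  else 1

end DiluteA

end

/-! Everything rests on two special values of the face weight. At `u = 0` it is `δ_{a,c}`. At `u =
3λ` it is the crossed identity `δ_{b,d} (S(a)/S(b))^{1/2} (S(c)/S(b))^{1/2}`. These are
`Regime.faceWeight_zero` and `Regime.faceWeight_three_mul`. In the fused weight at `u = 0` the left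
factor forces `c' = a` and the right one `c' = b`, so only `a = b = c'` can contribute. What remains
is a common factor times `∑ φ^α(a,a',a) (S(a')/S(a))^{1/2}` over the neighbours `a'` of `a`. Each
diagonal `φ^α` lives on exactly two of these neighbours, with opposite signs and modulus
`(S(e)/S(a'))^{1/2}` for a fixed spin `e`. The two terms are therefore `± (S(e)/S(a))^{1/2}` and
cancel (`Regime.sum_phi_self`).

Principal square roots may be multiplied in this way because all ratios of `S` on the spins are
positive (`Regime.exists_gauge`): `4λ = π ± π/(L+1)`, so the sign `(-1)^a` in `S` undoes the
alternation of `sin 4aλ`.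

The analytic difficulty is the weights of the form `0/0`. They occur only at `6λ = π` with `L = 2`,
or for `L` even at the two middle spins. There a reflection symmetry of `S` makes the numerator
vanish too, for every `u`. Since `θ₁` has simple zeros at the multiples of `π`, the limit is a
quotient of derivatives, and at `u = 3λ` it equals `1`, in agreement with crossing.

The statements on bond variables are finite case distinctions on `a - b` and on whether a spin is an
end of the diagram. -/

noncomputable section

namespace DiluteA

/-! ### Infinite products of theta type -/

/-- The deviation from `1` of a factor of a theta product. -/
def thetaTerm (q r : ℕ → ℝ) (n : ℕ) (u : ℂ) : ℂ :=
  (1 - 2 * (q n : ℂ) * Complex.cos (2 * u) + (q n : ℂ) ^ 2) * (1 - (r n : ℂ)) - 1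

/-- The common form of the products in `theta1` and `theta4`. -/
def thetaProd (q r : ℕ → ℝ) (u : ℂ) : ℂ := ∏' n, (1 + thetaTerm q r n u)

/-- A Weierstrass majorant: it depends on `u` only through `C` and is summable when `q` and `r` are.
Absolute values are needed because the nome may be negative. -/
theorem norm_thetaTerm_le {q r : ℕ → ℝ} (hq : ∀ n, |q n| < 1) (hr : ∀ n, |r n| < 1) {C : ℝ}
    {u : ℂ} (hC : ‖Complex.cos (2 * u)‖ ≤ C) (n : ℕ) :
    ‖thetaTerm q r n u‖ ≤ 2 * (2 * C + 1) * |q n| + |r n| := by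
  have h1 : thetaTerm q r n u =
      (-(2 * (q n : ℂ) * Complex.cos (2 * u)) + (q n : ℂ) * (q n : ℂ)) * (1 - (r n : ℂ))
        - (r n : ℂ) := by
    unfold thetaTerm; ring
  have h2 : ‖-(2 * (q n : ℂ) * Complex.cos (2 * u)) + (q n : ℂ) * (q n : ℂ)‖
      ≤ (2 * C + 1) * |q n| := by
    refine (norm_add_le _ _).trans ?_
    simp only [norm_neg, norm_mul, Complex.norm_real, Complex.norm_ofNat, Real.norm_eq_abs]
    nlinarith [abs_nonneg (q n), hq n, mul_le_mul_of_nonneg_left hC (abs_nonneg (q n))]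
  have h3 : ‖1 - (r n : ℂ)‖ ≤ 2 := by
    refine (norm_sub_le _ _).trans ?_
    simp only [norm_one, Complex.norm_real, Real.norm_eq_abs]
    linarith [hr n]
  rw [h1]
  refine (norm_sub_le _ _).trans ?_
  rw [norm_mul, Complex.norm_real, Real.norm_eq_abs]
  have := mul_le_mul h2 h3 (norm_nonneg _) ((norm_nonneg _).trans h2)
  linarith

/-- On a ball `cos 2u` is bounded by compactness, so the product converges locally uniformly there
and its limit is holomorphic. -/
theorem differentiable_thetaProd {q r : ℕ → ℝ} (hq : ∀ n, |q n| < 1) (hr : ∀ n, |r n| < 1)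
    (hqs : Summable q) (hrs : Summable r) : Differentiable ℂ (thetaProd q r) := by
  intro x
  have hcont : ContinuousOn (fun u : ℂ => Complex.cos (2 * u)) (Metric.closedBall x 1) := by
    fun_prop
  obtain ⟨C, hC⟩ := (isCompact_closedBall x 1).exists_bound_of_continuousOn hcont
  have hdiff : ∀ n, Differentiable ℂ (thetaTerm q r n) := fun n => by
    unfold thetaTerm; fun_prop
  have hprod : HasProdLocallyUniformlyOn (fun n u => 1 + thetaTerm q r n u) (thetaProd q r)
      (Metric.ball x 1) := by
    refine Summable.hasProdLocallyUniformlyOn_nat_one_add Metric.isOpen_ball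
      (u := fun n => 2 * (2 * C + 1) * |q n| + |r n|)
      ((hqs.abs.mul_left _).add hrs.abs) (.of_forall fun n u hu => ?_)
      (fun n => (hdiff n).continuous.continuousOn)
    exact norm_thetaTerm_le hq hr (hC u (Metric.ball_subset_closedBall hu)) n
  refine (hprod.differentiableOn (.of_forall fun s => ?_) Metric.isOpen_ball).differentiableAt
    (Metric.ball_mem_nhds x one_pos)
  have := DifferentiableOn.finsetProd (u := s) (s := Metric.ball x 1)
    (f := fun n u => 1 + thetaTerm q r n u) fun n _ => ((hdiff n).const_add 1).differentiableOn
  simpa only [Finset.prod_fn] using this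

/-- At real points each factor is at least `(1 - |q|)² (1 - r) > 0`. The product is the exponential
of a convergent sum of logarithms, so it does not degenerate to `0`. -/
theorem thetaProd_ofReal {q r : ℕ → ℝ} (hq : ∀ n, |q n| < 1) (hr : ∀ n, |r n| < 1)
    (hqs : Summable q) (hrs : Summable r) (x : ℝ) :
    ∃ y : ℝ, 0 < y ∧ thetaProd q r x = y := by
  set f : ℕ → ℝ := fun n => (1 - 2 * q n * Real.cos (2 * x) + q n ^ 2) * (1 - r n) - 1 with hf
  have hfc : ∀ n, thetaTerm q r n x = (f n : ℂ) := fun n => by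
    simp only [thetaTerm, hf]; push_cast; rfl
  have hpos : ∀ n, 0 < 1 + f n := fun n => by
    have h1 : 0 < 1 - r n := by linarith [(abs_lt.1 (hr n)).2]
    have h2 : 0 < 1 - 2 * q n * Real.cos (2 * x) + q n ^ 2 := by
      have h3 : |q n * Real.cos (2 * x)| ≤ |q n| := by
        rw [abs_mul]
        exact mul_le_of_le_one_right (abs_nonneg _) (Real.abs_cos_le_one _)
      have h4 : 0 < (1 - |q n|) ^ 2 := by
        have := hq n
        have : 0 < 1 - |q n| := by linarith
        positivity
      nlinarith [le_abs_self (q n * Real.cos (2 * x)), sq_abs (q n)]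
    have := mul_pos h2 h1
    simp only [hf]; linarith
  have hsum : Summable f := by
    refine Summable.of_norm_bounded (g := fun n => 2 * (2 * ‖Complex.cos (2 * x)‖ + 1) * |q n| + |r n|)
      ((hqs.abs.mul_left _).add hrs.abs) fun n => ?_
    have := norm_thetaTerm_le hq hr (le_refl ‖Complex.cos (2 * (x : ℂ))‖) n
    rwa [hfc, Complex.norm_real] at this
  refine ⟨∏' n, (1 + f n), ?_, ?_⟩
  · rw [← Real.rexp_tsum_eq_tprod hpos (Real.summable_log_one_add_of_summable hsum)]
    exact Real.exp_pos _
  · have h := (Real.multipliable_one_add_of_summable hsum).map_tprod Complex.ofRealHom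
      Complex.continuous_ofReal
    simp only [Complex.ofRealHom_eq_coe] at h
    rw [h, thetaProd]
    exact tprod_congr fun n => by rw [hfc]; push_cast; rfl

theorem thetaProd_neg (q r : ℕ → ℝ) (u : ℂ) : thetaProd q r (-u) = thetaProd q r u := by
  simp only [thetaProd, thetaTerm, mul_neg, Complex.cos_neg]

theorem thetaProd_add_pi (q r : ℕ → ℝ) (u : ℂ) :
    thetaProd q r (u + Real.pi) = thetaProd q r u := by
  simp only [thetaProd, thetaTerm, mul_add, Complex.cos_add_two_pi]

/-! ### The theta functions -/

section Theta

variable {p : ℝ}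

theorem abs_pow_lt_one (hp1 : |p| < 1) {n : ℕ} (hn : n ≠ 0) : |p ^ n| < 1 := by
  rw [abs_pow]; exact pow_lt_one₀ (abs_nonneg _) hp1 hn

theorem summable_pow_comp (hp1 : |p| < 1) {f : ℕ → ℕ} (hf : Function.Injective f) :
    Summable fun n => p ^ f n :=
  (summable_geometric_of_abs_lt_one hp1).comp_injective hf

theorem injective_two_mul_succ : Function.Injective fun n : ℕ => 2 * (n + 1) := fun a b h => by
  dsimp only at h; omega

theorem injective_two_mul_add_one : Function.Injective fun n : ℕ => 2 * n + 1 := fun a b h => by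
  dsimp only at h; omega

/-- The infinite product in `theta1`. -/
def theta1Prod (p : ℝ) : ℂ → ℂ :=
  thetaProd (fun n => p ^ (2 * (n + 1))) (fun n => p ^ (2 * (n + 1)))

theorem theta1_eq (p : ℝ) (u : ℂ) :
    theta1 p u = 2 * (p : ℂ) ^ (1 / 4 : ℂ) * Complex.sin u * theta1Prod p u := by
  unfold theta1 theta1Prod thetaProd thetaTerm
  congr 1
  refine tprod_congr fun n => ?_
  push_cast
  ring

theorem theta4_eq (p : ℝ) (u : ℂ) :
    theta4 p u = thetaProd (fun n => p ^ (2 * n + 1)) (fun n => p ^ (2 * (n + 1))) u := by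
  unfold theta4 thetaProd thetaTerm
  refine tprod_congr fun n => ?_
  push_cast
  ring

theorem theta1Prod_ofReal (hp1 : |p| < 1) (x : ℝ) : ∃ y : ℝ, 0 < y ∧ theta1Prod p x = y :=
  thetaProd_ofReal (fun _ => abs_pow_lt_one hp1 (by omega)) (fun _ => abs_pow_lt_one hp1 (by omega))
    (summable_pow_comp hp1 injective_two_mul_succ) (summable_pow_comp hp1 injective_two_mul_succ) x

theorem theta4_ofReal (hp1 : |p| < 1) (x : ℝ) : ∃ y : ℝ, 0 < y ∧ theta4 p x = y := by
  rw [theta4_eq]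
  exact thetaProd_ofReal (fun _ => abs_pow_lt_one hp1 (by omega))
    (fun _ => abs_pow_lt_one hp1 (by omega)) (summable_pow_comp hp1 injective_two_mul_add_one)
    (summable_pow_comp hp1 injective_two_mul_succ) x

theorem theta4_ofReal_ne_zero (hp1 : |p| < 1) (x : ℝ) : theta4 p x ≠ 0 := by
  obtain ⟨y, hy, h⟩ := theta4_ofReal hp1 x
  rw [h]; exact_mod_cast hy.ne'

theorem theta1Prod_ofReal_ne_zero (hp1 : |p| < 1) (x : ℝ) : theta1Prod p x ≠ 0 := by
  obtain ⟨y, hy, h⟩ := theta1Prod_ofReal hp1 x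
  rw [h]; exact_mod_cast hy.ne'

theorem differentiable_theta1Prod (hp1 : |p| < 1) : Differentiable ℂ (theta1Prod p) :=
  differentiable_thetaProd (fun _ => abs_pow_lt_one hp1 (by omega))
    (fun _ => abs_pow_lt_one hp1 (by omega))
    (summable_pow_comp hp1 injective_two_mul_succ) (summable_pow_comp hp1 injective_two_mul_succ)

theorem differentiable_theta4 (hp1 : |p| < 1) : Differentiable ℂ (theta4 p) := by
  rw [funext (theta4_eq p)]
  exact differentiable_thetaProd (fun _ => abs_pow_lt_one hp1 (by omega))
    (fun _ => abs_pow_lt_one hp1 (by omega)) (summable_pow_comp hp1 injective_two_mul_add_one)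
    (summable_pow_comp hp1 injective_two_mul_succ)

theorem differentiable_theta1 (hp1 : |p| < 1) : Differentiable ℂ (theta1 p) := by
  rw [funext (theta1_eq p)]
  exact (Complex.differentiable_sin.const_mul _).mul (differentiable_theta1Prod hp1)

/-- For negative `p` this constant is not real. Its value is irrelevant, since it cancels in every
ratio of `S`. -/
theorem theta1Const_ne_zero (hp : p ≠ 0) : 2 * (p : ℂ) ^ (1 / 4 : ℂ) ≠ 0 := by
  have hpc : (p : ℂ) ≠ 0 := by exact_mod_cast hp
  simp [Complex.cpow_eq_zero_iff, hpc]

theorem theta1_ofReal_eq_zero_iff (hp : p ≠ 0) (hp1 : |p| < 1) (x : ℝ) :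
    theta1 p x = 0 ↔ Real.sin x = 0 := by
  rw [theta1_eq, mul_eq_zero, mul_eq_zero, ← Complex.ofReal_sin, Complex.ofReal_eq_zero]
  simp only [theta1Const_ne_zero hp, theta1Prod_ofReal_ne_zero hp1, false_or, or_false]

theorem theta1_neg (p : ℝ) (u : ℂ) : theta1 p (-u) = -theta1 p u := by
  simp only [theta1_eq, theta1Prod, thetaProd_neg, Complex.sin_neg]; ring

theorem theta1_zero (p : ℝ) : theta1 p 0 = 0 := by
  simp [theta1_eq]

theorem theta1_add_pi (p : ℝ) (u : ℂ) : theta1 p (u + Real.pi) = -theta1 p u := by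
  simp only [theta1_eq, theta1Prod, thetaProd_add_pi, Complex.sin_add_pi]; ring

theorem theta4_neg (p : ℝ) (u : ℂ) : theta4 p (-u) = theta4 p u := by
  simp only [theta4_eq, thetaProd_neg]

theorem theta4_add_pi (p : ℝ) (u : ℂ) : theta4 p (u + Real.pi) = theta4 p u := by
  simp only [theta4_eq, thetaProd_add_pi]

theorem theta1_add_int_mul_pi (p : ℝ) (u : ℂ) (k : ℤ) :
    theta1 p (u + k * Real.pi) = (-1) ^ k * theta1 p u := by
  induction k with
  | zero => simp
  | succ i ih =>
    have : u + ((i + 1 : ℤ) : ℂ) * Real.pi = (u + (i : ℤ) * Real.pi) + Real.pi := by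
      push_cast; ring
    rw [this, theta1_add_pi, ih, zpow_add_one₀ (by norm_num)]; ring
  | pred i ih =>
    have : u + ((-(i : ℤ) : ℤ) : ℂ) * Real.pi = (u + ((-(i : ℤ) - 1 : ℤ) : ℂ) * Real.pi) + Real.pi := by
      push_cast; ring
    rw [this, theta1_add_pi] at ih
    rw [zpow_sub_one₀ (by norm_num), inv_neg_one]
    linear_combination -ih

theorem theta4_add_int_mul_pi (p : ℝ) (u : ℂ) (k : ℤ) :
    theta4 p (u + k * Real.pi) = theta4 p u := by
  have h : Function.Periodic (theta4 p) (Real.pi : ℂ) := theta4_add_pi p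
  exact h.int_mul k u

theorem hasDerivAt_theta1_zero (hp1 : |p| < 1) :
    ∃ κ : ℂ, HasDerivAt (theta1 p) κ 0 ∧ (p ≠ 0 → κ ≠ 0) := by
  refine ⟨2 * (p : ℂ) ^ (1 / 4 : ℂ) * theta1Prod p 0, ?_, fun hp => ?_⟩
  · have h := ((Complex.hasDerivAt_sin 0).const_mul (2 * (p : ℂ) ^ (1 / 4 : ℂ))).mul
      (differentiable_theta1Prod hp1 0).hasDerivAt
    simp only [Complex.cos_zero, Complex.sin_zero, mul_one, mul_zero, zero_mul, add_zero] at h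
    exact h.congr_of_eventuallyEq (.of_forall fun u => theta1_eq p u)
  · have := theta1Prod_ofReal_ne_zero hp1 0
    exact mul_ne_zero (theta1Const_ne_zero hp) (by simpa using this)

end Theta

/-! ### The admissible crossing parameters -/

/-- The data of the dilute model at its admissible crossing parameters
`lam = π K / (4 (L + 1))`, with `K = L + 2` or `K = L`. -/
structure Regime (L K : ℕ) (p lam : ℝ) : Prop where
  two_le : 2 ≤ L
  nome_ne_zero : p ≠ 0
  abs_nome_lt_one : |p| < 1
  numerator : K = L + 2 ∨ K = L
  crossing : 4 * (L + 1) * lam = Real.pi * K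
  sin_ne_zero : Real.sin (3 * lam) ≠ 0

theorem exists_regime {L : ℕ} {p lam : ℝ} (hL : 2 ≤ L) (hp : p ≠ 0) (hp1 : |p| < 1)
    (hlam : lam = Real.pi / 4 * ((L + 2) / (L + 1)) ∨ lam = Real.pi / 4 * (L / (L + 1)))
    (hsin : Real.sin (3 * lam) ≠ 0) : ∃ K, Regime L K p lam := by
  have h : (L : ℝ) + 1 ≠ 0 := by positivity
  rcases hlam with h1 | h1
  · exact ⟨L + 2, hL, hp, hp1, .inl rfl, by rw [h1]; push_cast; field_simp, hsin⟩
  · exact ⟨L, hL, hp, hp1, .inr rfl, by rw [h1]; field_simp, hsin⟩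

namespace Regime

variable {L K : ℕ} {p lam : ℝ}

theorem theta1_two_mul_ne_zero (h : Regime L K p lam) : theta1 p (2 * lam) ≠ 0 := by
  have h0 : theta1 p ((2 * lam : ℝ) : ℂ) ≠ 0 := by
    rw [Ne, theta1_ofReal_eq_zero_iff h.nome_ne_zero h.abs_nome_lt_one]
    have hK : 0 < (K : ℝ) ∧ (K : ℝ) < 2 * (L + 1) := by
      have h1 := h.two_le
      have h2 : 0 < K ∧ K < 2 * (L + 1) := by rcases h.numerator with h | h <;> omega
      exact_mod_cast h2
    have hl : 2 * lam = Real.pi * (K / (2 * (L + 1))) := by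
      have := h.crossing
      field_simp
      linarith
    rw [hl]
    refine (Real.sin_pos_of_pos_of_lt_pi (by have := hK.1; positivity) ?_).ne'
    refine mul_lt_of_lt_one_right Real.pi_pos ?_
    rw [div_lt_one (by positivity)]
    exact hK.2
  simpa using h0

theorem theta1_three_mul_ne_zero (h : Regime L K p lam) : theta1 p (3 * lam) ≠ 0 := by
  have h0 : theta1 p ((3 * lam : ℝ) : ℂ) ≠ 0 := by
    rw [Ne, theta1_ofReal_eq_zero_iff h.nome_ne_zero h.abs_nome_lt_one]
    exact h.sin_ne_zero
  simpa using h0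

/-- On the spins, `S` is a constant times a positive function. -/
theorem exists_gauge (h : Regime L K p lam) : ∃ (κ : ℂ) (g : ℤ → ℝ), κ ≠ 0 ∧
    ∀ a : ℤ, 1 ≤ a → a ≤ L → 0 < g a ∧ S p lam a = κ * g a := by
  -- Both regimes read `K = (L + 1) ± 1`. Hence `sin 4aλ = (-1)^a ε sin(aπ/(L+1))`, whose last
  -- factor is positive for `1 ≤ a ≤ L`; `ε` and the theta constant go into `κ`.
  have key : ∃ ε : ℝ, ε * ε = 1 ∧ 4 * lam = Real.pi + ε * (Real.pi / (L + 1)) := by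
    rcases h.numerator with hK | hK
    · refine ⟨1, by norm_num, ?_⟩
      have := h.crossing
      rw [hK] at this; push_cast at this
      field_simp; linarith
    · refine ⟨-1, by norm_num, ?_⟩
      have := h.crossing
      rw [hK] at this
      field_simp; linarith
  obtain ⟨ε, hε, hlam⟩ := key
  choose P hP0 hP using theta1Prod_ofReal h.abs_nome_lt_one
  choose Q hQ0 hQ using theta4_ofReal h.abs_nome_lt_one
  refine ⟨2 * (p : ℂ) ^ (1 / 4 : ℂ) * ε, fun a => Real.sin (a * (Real.pi / (L + 1))) *
    P (4 * a * lam) / Q (2 * a * lam), ?_, fun a ha1 ha2 => ⟨?_, ?_⟩⟩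
  · refine mul_ne_zero (theta1Const_ne_zero h.nome_ne_zero) ?_
    have : ε ≠ 0 := by rintro rfl; norm_num at hε
    exact_mod_cast this
  · have ha1' : (1 : ℝ) ≤ a := by exact_mod_cast ha1
    have ha2' : (a : ℝ) ≤ L := by exact_mod_cast ha2
    have hs : 0 < Real.sin (a * (Real.pi / (L + 1))) := by
      refine Real.sin_pos_of_pos_of_lt_pi (by have := Real.pi_pos; positivity) ?_
      rw [mul_div_assoc', div_lt_iff₀ (by positivity), mul_comm]
      exact mul_lt_mul_of_pos_left (by linarith) Real.pi_pos
    have := hP0 (4 * a * lam)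
    have := hQ0 (2 * a * lam)
    positivity
  · have hs : Real.sin (4 * a * lam) = (-1) ^ a * (ε * Real.sin (a * (Real.pi / (L + 1)))) := by
      have : 4 * a * lam = a * (ε * (Real.pi / (L + 1))) + a * Real.pi := by
        linear_combination (a : ℝ) * hlam
      rw [this, Real.sin_add_int_mul_pi]
      congr 1
      rcases mul_self_eq_one_iff.1 hε with rfl | rfl
      · simp
      · rw [neg_one_mul, neg_one_mul, mul_neg, Real.sin_neg]
    have h1 := hP (4 * a * lam)
    have h4 := hQ (2 * a * lam)
    have hs' := congrArg (fun x : ℝ => (x : ℂ)) hs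
    push_cast at h1 h4 hs'
    have hsq : ((-1 : ℂ) ^ a) * (-1) ^ a = 1 := by
      rw [← mul_zpow]; norm_num
    simp only [S, theta1_eq, h1, h4, hs']
    push_cast
    linear_combination (2 * (p : ℂ) ^ (1 / 4 : ℂ) * ε * Complex.sin (a * (Real.pi / (L + 1))) *
      P (4 * a * lam) / Q (2 * a * lam)) * hsq

theorem S_zero (p lam : ℝ) : S p lam 0 = 0 := by
  simp [S, theta1_zero]

theorem S_last (h : Regime L K p lam) : S p lam (L + 1) = 0 := by
  have h1 : (4 * ((L + 1 : ℤ) : ℂ) * lam) = 0 + ((K : ℤ) : ℂ) * Real.pi := by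
    have := congrArg (fun x : ℝ => (x : ℂ)) h.crossing
    push_cast at this ⊢
    linear_combination this
  rw [S, h1, theta1_add_int_mul_pi, theta1_zero]
  simp

/-- The angle `4aλ` is `-4bλ` up to `Kπ` with `K` even, so `θ₁` changes sign while `θ₄` does not. As
`a + b` is odd, `(-1)^a` changes sign as well. -/
theorem S_reflect (h : Regime L K p lam) (hL : Even L) {a b : ℤ}
    (hab : a + b = L + 1) : S p lam a = S p lam b := by
  have hK : Even (K : ℤ) := by
    rcases h.numerator with hK | hK <;> rw [hK] <;> exact_mod_cast (by grind)
  obtain ⟨M, hM⟩ := hK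
  have hab' : (a : ℂ) = L + 1 - b := by
    have : (a : ℂ) + b = L + 1 := by exact_mod_cast hab
    linear_combination this
  have hl := congrArg (fun x : ℝ => (x : ℂ)) h.crossing
  have hKc : (K : ℂ) = M + M := by exact_mod_cast hM
  push_cast at hl
  have h1 : (4 * (a : ℂ) * lam) = -(4 * b * lam) + ((M + M : ℤ) : ℂ) * Real.pi := by
    rw [hab']; push_cast; linear_combination hl + Real.pi * hKc
  have h4 : (2 * (a : ℂ) * lam) = -(2 * b * lam) + (M : ℂ) * Real.pi := by
    rw [hab']; linear_combination hl / 2 + Real.pi * hKc / 2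
  have hs : (-1 : ℂ) ^ a = -(-1) ^ b := by
    have ha : a = (L - 2 * b) + b + 1 := by linarith
    have he : Even ((L : ℤ) - 2 * b) := by
      have : Even (L : ℤ) := by exact_mod_cast hL
      exact this.sub (even_two_mul b)
    rw [ha, zpow_add_one₀ (by norm_num), zpow_add₀ (by norm_num), he.neg_one_zpow]
    ring
  rw [S, S, h1, h4, theta1_add_int_mul_pi, theta4_add_int_mul_pi, theta1_neg, theta4_neg, hs,
    Even.neg_one_zpow ⟨M, rfl⟩]
  ring

/-- `θ₁(6λ) = 0` forces `L = 2`, `λ = π / 6`. -/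
theorem eq_of_theta1_six_mul_eq_zero (h : Regime L K p lam) (h6 : theta1 p (6 * lam) = 0) :
    L = 2 ∧ 6 * lam = Real.pi := by
  have h0 : theta1 p ((6 * lam : ℝ) : ℂ) = 0 := by simpa using h6
  rw [theta1_ofReal_eq_zero_iff h.nome_ne_zero h.abs_nome_lt_one, Real.sin_eq_zero_iff] at h0
  obtain ⟨m, hm⟩ := h0
  have h1 : (3 * K : ℤ) = 2 * (L + 1) * m := by
    have : Real.pi * (3 * K : ℝ) = Real.pi * (2 * (L + 1) * m) := by
      linear_combination -3 * h.crossing - 2 * (L + 1) * hm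
    exact_mod_cast mul_left_cancel₀ Real.pi_ne_zero this
  -- `K ≡ ±1` modulo `L + 1`, so it can be cancelled from `3K = 2(L+1)m`.
  have hdvd : ((L : ℤ) + 1) ∣ 3 := by
    rcases h.numerator with hK | hK
    · exact ⟨2 * m - 3, by rw [hK] at h1; push_cast at h1; linarith⟩
    · exact ⟨3 - 2 * m, by rw [hK] at h1; linarith⟩
  have hL := h.two_le
  have hL2 : L = 2 := by
    have := Int.le_of_dvd (by norm_num) hdvd
    omega
  refine ⟨hL2, ?_⟩
  subst hL2
  have hc := h.crossing
  rcases h.numerator with hK | hK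
  · subst hK
    exfalso
    apply h.sin_ne_zero
    have : 3 * lam = Real.pi := by push_cast at hc; linarith
    rw [this, Real.sin_pi]
  · subst hK
    push_cast at hc; linarith

/-- `θ₁(±4bλ + 2λ) = 0` only happens at the middle of a diagram with an even number of nodes. -/
theorem eq_of_theta1_mid_eq_zero (h : Regime L K p lam) {a b : ℤ}
    (ha1 : 1 ≤ a) (haL : a ≤ L) (hb1 : 1 ≤ b) (hbL : b ≤ L)
    (hab : a - b = 1 ∨ a - b = -1)
    (h0 : theta1 p ((a - b) * 4 * b * lam + 2 * lam) = 0) :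
    Even L ∧ a + b = L + 1 ∧ ∃ k : ℤ, ((a - b) * 4 * b + 2) * lam = k * Real.pi := by
  have h0 : theta1 p ((((a - b) * 4 * b + 2) * lam : ℝ) : ℂ) = 0 := by
    rw [← h0]; push_cast; congr 1; ring
  rw [theta1_ofReal_eq_zero_iff h.nome_ne_zero h.abs_nome_lt_one, Real.sin_eq_zero_iff] at h0
  obtain ⟨k, hk⟩ := h0
  have h1 : (2 * (a - b) * b + 1) * (K : ℤ) = 2 * (L + 1) * k := by
    have : Real.pi * ((2 * (a - b) * b + 1) * (K : ℝ)) = Real.pi * (2 * (L + 1) * k) := by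
      linear_combination -(2 * (a - b) * b + 1) * h.crossing - 2 * (L + 1) * hk
    exact_mod_cast mul_left_cancel₀ Real.pi_ne_zero this
  -- Since `(a - b)² = 1`, this number is `(a - b)(a + b)`. So `L + 1` divides `a + b`, which lies
  -- strictly between `0` and `2(L + 1)`. Moreover `a + b` is odd, which makes `L` even.
  have hdvd : ((L : ℤ) + 1) ∣ 2 * (a - b) * b + 1 := by
    rcases h.numerator with hK | hK
    · exact ⟨2 * k - (2 * (a - b) * b + 1), by rw [hK] at h1; push_cast at h1; linarith⟩
    · exact ⟨(2 * (a - b) * b + 1) - 2 * k, by rw [hK] at h1; linarith⟩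
  obtain ⟨q, hq⟩ := hdvd
  have hsum : a + b = L + 1 := by
    rcases hab with hab | hab
    · rw [hab] at hq
      have hq0 : 0 < q := by nlinarith
      have hq2 : q < 2 := by nlinarith
      have : q = 1 := by omega
      rw [this] at hq; linarith
    · rw [hab] at hq
      have hq0 : q < 0 := by nlinarith
      have hq2 : -2 < q := by nlinarith
      have : q = -1 := by omega
      rw [this] at hq; linarith
  refine ⟨?_, hsum, k, hk.symm⟩
  rw [Nat.even_iff]; omega

end Regime

/-! ### Square roots of positive numbers -/

theorem root_ofReal {x : ℝ} (hx : 0 ≤ x) : root (x : ℂ) = (Real.sqrt x : ℝ) := by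
  rw [root, Real.sqrt_eq_rpow, Complex.ofReal_cpow hx]
  norm_num

theorem root_ne_zero {z : ℂ} (hz : z ≠ 0) : root z ≠ 0 := by
  simp [root, Complex.cpow_eq_zero_iff, hz]

theorem root_one : root 1 = 1 := by simp [root]

namespace Regime

variable {L K : ℕ} {p lam : ℝ}

theorem S_ne_zero (h : Regime L K p lam) {a : ℤ} (ha1 : 1 ≤ a) (haL : a ≤ L) :
    S p lam a ≠ 0 := by
  obtain ⟨κ, g, hκ, hg⟩ := h.exists_gauge
  obtain ⟨h1, h2⟩ := hg a ha1 haL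
  rw [h2]
  exact mul_ne_zero hκ (by exact_mod_cast h1.ne')

theorem S_div_S (h : Regime L K p lam) {a b : ℤ} (ha1 : 1 ≤ a) (haL : a ≤ L) (hb1 : 1 ≤ b)
    (hbL : b ≤ L) : ∃ r : ℝ, 0 < r ∧ S p lam a / S p lam b = r := by
  obtain ⟨κ, g, hκ, hg⟩ := h.exists_gauge
  obtain ⟨h1, h2⟩ := hg a ha1 haL
  obtain ⟨h3, h4⟩ := hg b hb1 hbL
  refine ⟨g a / g b, by positivity, ?_⟩
  rw [h2, h4, mul_div_mul_left _ _ hκ]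
  push_cast; rfl

/-- Multiplicativity fails for principal roots in general; here both radicands are positive reals.
-/
theorem root_mul_root (h : Regime L K p lam) {a b c : ℤ} (ha1 : 1 ≤ a) (haL : a ≤ L)
    (hb1 : 1 ≤ b) (hbL : b ≤ L) (hc1 : 1 ≤ c) (hcL : c ≤ L) :
    root (S p lam a / S p lam b) * root (S p lam b / S p lam c) =
      root (S p lam a / S p lam c) := by
  obtain ⟨r, hr, hr'⟩ := h.S_div_S ha1 haL hb1 hbL
  obtain ⟨s, hs, hs'⟩ := h.S_div_S hb1 hbL hc1 hcL
  have : S p lam a / S p lam c = (r * s : ℝ) := by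
    push_cast
    rw [← hr', ← hs', div_mul_div_cancel₀ (h.S_ne_zero hb1 hbL)]
  rw [this, hr', hs', root_ofReal hr.le, root_ofReal hs.le, root_ofReal (by positivity),
    Real.sqrt_mul hr.le]
  push_cast; rfl

theorem root_mul_root_self (h : Regime L K p lam) {a b : ℤ} (ha1 : 1 ≤ a) (haL : a ≤ L)
    (hb1 : 1 ≤ b) (hbL : b ≤ L) :
    root (S p lam a / S p lam b) * root (S p lam a / S p lam b) = S p lam a / S p lam b := by
  obtain ⟨r, hr, hr'⟩ := h.S_div_S ha1 haL hb1 hbL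
  rw [hr', root_ofReal hr.le, ← Complex.ofReal_mul, Real.mul_self_sqrt hr.le]

theorem root_mul_div_sq (h : Regime L K p lam) {a b c : ℤ} (ha1 : 1 ≤ a) (haL : a ≤ L)
    (hb1 : 1 ≤ b) (hbL : b ≤ L) (hc1 : 1 ≤ c) (hcL : c ≤ L) :
    root (S p lam a * S p lam c / S p lam b ^ 2) =
      root (S p lam a / S p lam b) * root (S p lam c / S p lam b) := by
  obtain ⟨r, hr, hr'⟩ := h.S_div_S ha1 haL hb1 hbL
  obtain ⟨s, hs, hs'⟩ := h.S_div_S hc1 hcL hb1 hbL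
  have : S p lam a * S p lam c / S p lam b ^ 2 = (r * s : ℝ) := by
    push_cast
    rw [← hr', ← hs', div_mul_div_comm, sq]
  rw [this, hr', hs', root_ofReal hr.le, root_ofReal hs.le, root_ofReal (by positivity),
    Real.sqrt_mul hr.le]
  push_cast; rfl

theorem root_self (h : Regime L K p lam) {a : ℤ} (ha1 : 1 ≤ a) (haL : a ≤ L) :
    root (S p lam a / S p lam a) = 1 := by
  rw [div_self (h.S_ne_zero ha1 haL), root_one]

end Regime

/-! ### The explicit weights, one shape of the face at a time -/

theorem int_abs_sub_le_one {a b : ℤ} (hab : |a - b| ≤ 1) : a = b ∨ a = b + 1 ∨ a = b - 1 := by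
  rw [abs_le] at hab; omega

/-- A face with adjacent corners has one of ten shapes. -/
theorem face_cases {P : ℤ → ℤ → ℤ → ℤ → Prop} (h1 : ∀ a, P a a a a)
    (h2 : ∀ a b, |a - b| = 1 → P a b b a) (h2' : ∀ a b, |a - b| = 1 → P a a b b)
    (h3 : ∀ a b, |a - b| = 1 → P a a a b) (h3' : ∀ a b, |a - b| = 1 → P a b a a)
    (h4 : ∀ a b, |a - b| = 1 → P a b b b) (h4' : ∀ a b, |a - b| = 1 → P b b a b)
    (h5 : ∀ a b, |a - b| = 1 → P a b a (2 * a - b))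
    (h6 : ∀ a b, |a - b| = 1 → P a b (2 * b - a) b)
    (h7 : ∀ a b, |a - b| = 1 → P a b a b) {a b c d : ℤ}
    (hab : |a - b| ≤ 1) (hbc : |b - c| ≤ 1) (hcd : |c - d| ≤ 1) (hda : |d - a| ≤ 1) :
    P a b c d := by
  have habs : ∀ x y : ℤ, x = y + 1 ∨ x = y - 1 → |x - y| = 1 := fun x y h => by
    rw [abs_eq one_pos.le]; omega
  by_cases hac : a = c
  · subst hac
    rcases int_abs_sub_le_one hab with rfl | hab'
    · rcases int_abs_sub_le_one hcd with rfl | hcd'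
      · exact h1 _
      · exact h3 _ _ (habs _ _ hcd')
    · rcases int_abs_sub_le_one hcd with rfl | hcd'
      · exact h3' _ _ (habs _ _ hab')
      · by_cases hbd : b = d
        · subst hbd; exact h7 _ _ (habs _ _ hab')
        · obtain rfl : d = 2 * a - b := by omega
          exact h5 _ _ (habs _ _ hab')
  · have hbc' := int_abs_sub_le_one hbc
    have hcd' := int_abs_sub_le_one hcd
    have hda' := int_abs_sub_le_one hda
    rcases int_abs_sub_le_one hab with rfl | hab'
    · by_cases had : a = d
      · subst had; exact h4' _ _ (habs _ _ (by omega))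
      · obtain rfl : c = d := by omega
        exact h2' _ _ (habs _ _ (by omega))
    · by_cases had : a = d
      · subst had
        obtain rfl : b = c := by omega
        exact h2 _ _ (habs _ _ hab')
      · obtain rfl : b = d := by omega
        by_cases hbc : b = c
        · subst hbc; exact h4 _ _ (habs _ _ hab')
        · obtain rfl : c = 2 * b - a := by omega
          exact h6 _ _ (habs _ _ hab')

section Shapes

variable (p l : ℝ) {a b : ℤ}

theorem rawWeight_const (a : ℤ) (u : ℂ) : rawWeight p l a a a a u =
    theta1 p (6 * l - u) * theta1 p (3 * l + u) / (theta1 p (6 * l) * theta1 p (3 * l)) -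
      (S p l (a + 1) / S p l a * (theta4 p (2 * a * l - 5 * l) / theta4 p (2 * a * l + l)) +
        S p l (a - 1) / S p l a * (theta4 p (2 * a * l + 5 * l) / theta4 p (2 * a * l - l))) *
      (theta1 p u * theta1 p (3 * l - u) / (theta1 p (6 * l) * theta1 p (3 * l))) := by
  simp [rawWeight]

theorem rawWeight_vertical (hab : |a - b| = 1) (u : ℂ) : rawWeight p l a b b a u =
    theta1 p u * theta1 p (3 * l - u) / (theta1 p (2 * l) * theta1 p (3 * l)) *
      root (theta4 p (((b - a : ℤ) : ℂ) * 2 * a * l + 3 * l) *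
        theta4 p (((b - a : ℤ) : ℂ) * 2 * a * l - l) /
          theta4 p (((b - a : ℤ) : ℂ) * 2 * a * l + l) ^ 2) := by
  have hne : a ≠ b := by rintro rfl; simp at hab
  simp only [rawWeight, hne, hne.symm, abs_sub_comm b a, hab, false_and, and_false, or_false,
    if_false, true_and, and_true, if_true]

theorem rawWeight_horizontal (hab : |a - b| = 1) (u : ℂ) : rawWeight p l a a b b u =
    theta1 p u * theta1 p (3 * l - u) / (theta1 p (2 * l) * theta1 p (3 * l)) *
      root (theta4 p (((b - a : ℤ) : ℂ) * 2 * a * l + 3 * l) *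
        theta4 p (((b - a : ℤ) : ℂ) * 2 * a * l - l) /
          theta4 p (((b - a : ℤ) : ℂ) * 2 * a * l + l) ^ 2) := by
  have hne : a ≠ b := by rintro rfl; simp at hab
  simp only [rawWeight, hne, hne.symm, abs_sub_comm b a, hab, false_and, and_false, or_false,
    false_or, if_false, true_and, and_true, if_true]

theorem rawWeight_top_left (hab : |a - b| = 1) (u : ℂ) : rawWeight p l a a a b u =
    theta1 p (3 * l - u) * theta4 p (((b - a : ℤ) : ℂ) * 2 * a * l + l - u) /
      (theta1 p (3 * l) * theta4 p (((b - a : ℤ) : ℂ) * 2 * a * l + l)) := by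
  have hne : a ≠ b := by rintro rfl; simp at hab
  simp only [rawWeight, hne, hne.symm, abs_sub_comm b a, hab, false_and, and_false, or_false,
    if_false, true_and, and_true, if_true]

theorem rawWeight_bottom_right (hab : |a - b| = 1) (u : ℂ) : rawWeight p l a b a a u =
    theta1 p (3 * l - u) * theta4 p (((b - a : ℤ) : ℂ) * 2 * a * l + l - u) /
      (theta1 p (3 * l) * theta4 p (((b - a : ℤ) : ℂ) * 2 * a * l + l)) := by
  have hne : a ≠ b := by rintro rfl; simp at hab
  simp only [rawWeight, hne, hne.symm, abs_sub_comm b a, hab, false_and, and_false, or_false,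
      false_or, if_false, true_and, and_true, if_true]

theorem rawWeight_bottom_left (hab : |a - b| = 1) (u : ℂ) : rawWeight p l a b b b u =
    root (S p l a / S p l b) *
      (theta1 p u * theta4 p (((a - b : ℤ) : ℂ) * 2 * b * l - 2 * l + u) /
        (theta1 p (3 * l) * theta4 p (((a - b : ℤ) : ℂ) * 2 * b * l + l))) := by
  have hne : a ≠ b := by rintro rfl; simp at hab
  simp only [rawWeight, hne, hne.symm, abs_sub_comm b a, hab, false_and, and_false, or_false,
    if_false, true_and, and_true, if_true, add_sub_cancel]

theorem rawWeight_top_right (hab : |a - b| = 1) (u : ℂ) : rawWeight p l b b a b u =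
    root (S p l a / S p l b) *
      (theta1 p u * theta4 p (((a - b : ℤ) : ℂ) * 2 * b * l - 2 * l + u) /
        (theta1 p (3 * l) * theta4 p (((a - b : ℤ) : ℂ) * 2 * b * l + l))) := by
  have hne : a ≠ b := by rintro rfl; simp at hab
  simp only [rawWeight, hne, hne.symm, hab, false_and, and_false, or_false,
      false_or, if_false, true_and, and_true, if_true, add_sub_cancel]

theorem rawWeight_slope_down (hab : |a - b| = 1) (u : ℂ) : rawWeight p l a b a (2 * a - b) u =
    theta1 p (2 * l - u) * theta1 p (3 * l - u) / (theta1 p (2 * l) * theta1 p (3 * l)) := by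
  have hne : a ≠ b := by rintro rfl; simp at hab
  have h1 : 2 * a - b ≠ a := by omega
  have h2 : 2 * a - b - a = -(b - a) := by ring
  simp only [rawWeight, hne, hne.symm, h1, h1.symm, h2, abs_sub_comm b a, hab, false_and,
    and_false, or_false,
    if_false, true_and, and_true, if_true]

theorem rawWeight_slope_up (hab : |a - b| = 1) (u : ℂ) : rawWeight p l a b (2 * b - a) b u =
    -root (S p l (b - 1) * S p l (b + 1) / S p l b ^ 2) *
      (theta1 p u * theta1 p (l - u) / (theta1 p (2 * l) * theta1 p (3 * l))) := by
  have hne : a ≠ b := by rintro rfl; simp at hab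
  have h1 : 2 * b - a ≠ b := by omega
  have h2 : 2 * b - a - b = -(a - b) := by ring
  have h3 : 2 * b - a ≠ a := by omega
  simp only [rawWeight, hne, hne.symm, h1, h1.symm, h2, h3.symm, abs_sub_comm b a, hab, false_and,
    and_false, or_false,
    if_false, true_and, and_true, if_true]

theorem rawWeight_flip (hab : |a - b| = 1) (u : ℂ) : rawWeight p l a b a b u =
    theta1 p (3 * l - u) * theta1 p ((a - b) * 4 * b * l + 2 * l + u) /
        (theta1 p (3 * l) * theta1 p ((a - b) * 4 * b * l + 2 * l)) +
      S p l a / S p l b *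
      (theta1 p u * theta1 p ((a - b) * 4 * b * l - l + u) /
        (theta1 p (3 * l) * theta1 p ((a - b) * 4 * b * l + 2 * l))) := by
  have hne : a ≠ b := by rintro rfl; simp at hab
  have h1 : ¬ b - a = -(b - a) := by omega
  have h2 : ¬ a - b = -(a - b) := by omega
  simp only [rawWeight, hne, hne.symm, h1, h2, hab, false_and, and_false, or_self, if_false,
    and_self, if_true, add_sub_cancel]
  push_cast
  rfl

end Shapes

/-! ### The explicit weights at `u = 0` and `u = 3 λ` -/

theorem theta4_real_ne_zero {p : ℝ} (hp1 : |p| < 1) {z : ℂ} (hz : z.im = 0) :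
    theta4 p z ≠ 0 := by
  rw [show z = (z.re : ℂ) from Complex.ext rfl hz]
  exact theta4_ofReal_ne_zero hp1 _

theorem ne_of_abs_sub_eq_one {a b : ℤ} (hab : |a - b| = 1) : a ≠ b := by
  rintro rfl; simp at hab

/-- The parameter `l` is not tied to a regime, so that the identity also holds near `lam` and passes
to the limit at exceptional faces. Terms containing `θ₁(u)` vanish, and the others reduce to `1`. -/
theorem rawWeight_zero {p l : ℝ} (hp1 : |p| < 1) (h2 : theta1 p (2 * l) ≠ 0)
    (h3 : theta1 p (3 * l) ≠ 0) {a b c d : ℤ}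
    (hab : |a - b| ≤ 1) (hbc : |b - c| ≤ 1) (hcd : |c - d| ≤ 1) (hda : |d - a| ≤ 1)
    (hE : ¬ Exceptional p l a b c d) :
    rawWeight p l a b c d 0 = if a = c then 1 else 0 := by
  have h4 : ∀ s a : ℤ, theta4 p (s * 2 * a * l + l) ≠ 0 := fun s a =>
    theta4_real_ne_zero hp1 (by simp [Complex.mul_im])
  revert hE
  refine face_cases (P := fun a b c d => ¬ Exceptional p l a b c d →
    rawWeight p l a b c d 0 = if a = c then 1 else 0)
    ?_ ?_ ?_ ?_ ?_ ?_ ?_ ?_ ?_ ?_ hab hbc hcd hda <;> intro a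
  on_goal 1 => intro hE
  on_goal 10 => intro b hab hE
  all_goals try intro b hab _
  all_goals try have hne := ne_of_abs_sub_eq_one hab
  · have h6 : theta1 p (6 * l) ≠ 0 := fun h => hE (.inl ⟨rfl, rfl, rfl, h⟩)
    simp [rawWeight_const, theta1_zero, h6, h3]
  · simp [rawWeight_vertical p l hab, theta1_zero, hne]
  · simp [rawWeight_horizontal p l hab, theta1_zero, hne]
  · simp only [rawWeight_top_left p l hab, sub_zero, if_true]
    exact div_self (mul_ne_zero h3 (h4 _ _))
  · simp only [rawWeight_bottom_right p l hab, sub_zero, if_true]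
    exact div_self (mul_ne_zero h3 (h4 _ _))
  · simp [rawWeight_bottom_left p l hab, theta1_zero, hne]
  · simp [rawWeight_top_right p l hab, theta1_zero, hne.symm]
  · simp [rawWeight_slope_down p l hab, h2, h3]
  · have : a ≠ 2 * b - a := by omega
    simp [rawWeight_slope_up p l hab, theta1_zero, this]
  · have h7 : theta1 p ((a - b) * 4 * b * l + 2 * l) ≠ 0 := fun h =>
      hE (.inr ⟨rfl, rfl, hab, h⟩)
    simp [rawWeight_flip p l hab, theta1_zero, h7, h3]

/-- Terms containing `θ₁(3λ - u)` vanish, and the surviving prefactors are the gauge factors of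
crossing symmetry. Unlike at `u = 0`, the limit cannot be read off from this: `u = 3 * lam` stays
fixed while `l` varies. -/
theorem Regime.rawWeight_three_mul {L K : ℕ} {p lam : ℝ} (h : Regime L K p lam) {a b c d : ℤ}
    (ha : 1 ≤ a ∧ a ≤ L) (hb : 1 ≤ b ∧ b ≤ L) (hc : 1 ≤ c ∧ c ≤ L)
    (hab : |a - b| ≤ 1) (hbc : |b - c| ≤ 1) (hcd : |c - d| ≤ 1) (hda : |d - a| ≤ 1)
    (hE : ¬ Exceptional p lam a b c d) :
    rawWeight p lam a b c d (3 * lam) =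
      if b = d then root (S p lam a / S p lam b) * root (S p lam c / S p lam b) else 0 := by
  have h2 := h.theta1_two_mul_ne_zero
  have h3 := h.theta1_three_mul_ne_zero
  have h4 : ∀ s a : ℤ, theta4 p (s * 2 * a * lam + lam) ≠ 0 := fun s a =>
    theta4_real_ne_zero h.abs_nome_lt_one (by simp [Complex.mul_im])
  have e1 : (6 * lam - 3 * lam : ℂ) = 3 * lam := by ring
  have e2 : (3 * lam + 3 * lam : ℂ) = 6 * lam := by ring
  have e3 : ∀ z : ℂ, z - 2 * lam + 3 * lam = z + lam := fun z => by ring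
  have e4 : ∀ z : ℂ, z - lam + 3 * lam = z + 2 * lam := fun z => by ring
  have e5 : (lam - 3 * lam : ℂ) = -(2 * lam) := by ring
  revert hE ha hb hc
  refine face_cases (P := fun a b c d => 1 ≤ a ∧ a ≤ (L : ℤ) → 1 ≤ b ∧ b ≤ (L : ℤ) →
    1 ≤ c ∧ c ≤ (L : ℤ) → ¬ Exceptional p lam a b c d → rawWeight p lam a b c d (3 * lam) =
      if b = d then root (S p lam a / S p lam b) * root (S p lam c / S p lam b) else 0)
    ?_ ?_ ?_ ?_ ?_ ?_ ?_ ?_ ?_ ?_ hab hbc hcd hda <;> intro a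
  on_goal 1 => intro ha _ _ hE
  all_goals try intro b hab ha hb hc hE
  all_goals try have hne := ne_of_abs_sub_eq_one hab
  · have h6 : theta1 p (6 * lam) ≠ 0 := fun h => hE (.inl ⟨rfl, rfl, rfl, h⟩)
    simp only [rawWeight_const, e1, e2, sub_self, theta1_zero, mul_zero, zero_div, sub_zero,
      h.root_self ha.1 ha.2, if_true, mul_one]
    rw [mul_comm, div_self (mul_ne_zero h6 h3)]
  · simp [rawWeight_vertical p lam hab, theta1_zero, hne.symm]
  · simp [rawWeight_horizontal p lam hab, theta1_zero, hne]
  · simp [rawWeight_top_left p lam hab, theta1_zero, hne]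
  · simp [rawWeight_bottom_right p lam hab, theta1_zero, hne.symm]
  · simp only [rawWeight_bottom_left p lam hab, e3, h.root_self hb.1 hb.2, if_true, mul_one]
    rw [div_self (mul_ne_zero h3 (h4 _ _)), mul_one]
  · simp only [rawWeight_top_right p lam hab, e3, h.root_self hb.1 hb.2, if_true, one_mul]
    rw [div_self (mul_ne_zero h3 (h4 _ _)), mul_one]
  · have : b ≠ 2 * a - b := by omega
    simp [rawWeight_slope_down p lam hab, theta1_zero, this]
  · have key : root (S p lam (b - 1) * S p lam (b + 1) / S p lam b ^ 2) =
        root (S p lam a / S p lam b) * root (S p lam (2 * b - a) / S p lam b) := by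
      rcases (abs_eq one_pos.le).1 hab with h1 | h1
      · obtain rfl : a = b + 1 := by omega
        rw [show 2 * b - (b + 1) = b - 1 by ring] at hc ⊢
        rw [mul_comm (S p lam (b - 1))]
        exact h.root_mul_div_sq ha.1 ha.2 hb.1 hb.2 hc.1 hc.2
      · obtain rfl : a = b - 1 := by omega
        rw [show 2 * b - (b - 1) = b + 1 by ring] at hc ⊢
        exact h.root_mul_div_sq ha.1 ha.2 hb.1 hb.2 hc.1 hc.2
    rw [rawWeight_slope_up p lam hab, key, e5, theta1_neg, if_pos rfl, mul_neg, neg_div,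
      mul_comm (theta1 p (3 * lam)), div_self (mul_ne_zero h2 h3), neg_mul_neg, mul_one]
  · have h7 : theta1 p ((a - b) * 4 * b * lam + 2 * lam) ≠ 0 := fun h =>
      hE (.inr ⟨rfl, rfl, hab, h⟩)
    rw [rawWeight_flip p lam hab, e4, sub_self, theta1_zero, if_pos rfl,
      h.root_mul_root_self ha.1 ha.2 hb.1 hb.2, div_self (mul_ne_zero h3 h7)]
    ring

/-! ### Removable singularities of the explicit weights -/

theorem hasDerivAt_comp_affine {f : ℂ → ℂ} {f' c d : ℂ} {x : ℝ}
    (hf : HasDerivAt f f' (c * x + d)) : HasDerivAt (fun l : ℝ => f (c * l + d)) (c * f') x := by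
  have h1 : HasDerivAt (fun z : ℂ => c * z + d) c (x : ℂ) := by
    simpa using ((hasDerivAt_id (x : ℂ)).const_mul c).add_const d
  have h2 := (HasDerivAt.comp (x : ℂ) hf h1).comp_ofReal
  rw [mul_comm c]
  exact h2

/-- First-order l'Hôpital rule: off `x` the quotient is the quotient of the two slopes. -/
theorem tendsto_div_of_hasDerivAt {N D : ℝ → ℂ} {N' D' : ℂ} {x : ℝ} (hN : HasDerivAt N N' x)
    (hD : HasDerivAt D D' x) (hN0 : N x = 0) (hD0 : D x = 0) (hD' : D' ≠ 0) :
    Tendsto (fun l => N l / D l) (𝓝[≠] x) (𝓝 (N' / D')) := by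
  refine ((hasDerivAt_iff_tendsto_slope.1 hN).div (hasDerivAt_iff_tendsto_slope.1 hD) hD').congr' ?_
  filter_upwards [self_mem_nhdsWithin] with l hl
  have : ((l - x : ℝ) : ℂ) ≠ 0 := by exact_mod_cast sub_ne_zero.2 hl
  simp only [Pi.div_apply, slope_def_module, hN0, hD0, sub_zero, Complex.real_smul,
    Complex.ofReal_inv]
  exact mul_div_mul_left _ _ (inv_ne_zero this)

theorem hasDerivAt_theta1_int_mul_pi {p : ℝ} {κ : ℂ} (hκ : HasDerivAt (theta1 p) κ 0) (k : ℤ) :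
    HasDerivAt (theta1 p) ((-1) ^ k * κ) (k * Real.pi) := by
  have h1 : HasDerivAt (theta1 p) κ ((k : ℂ) * Real.pi - k * Real.pi) := by rwa [sub_self]
  refine ((h1.comp_sub_const _ _).const_mul ((-1 : ℂ) ^ k)).congr_of_eventuallyEq
    (.of_forall fun u => ?_)
  have := theta1_add_int_mul_pi p (u - k * Real.pi) k
  rwa [sub_add_cancel] at this

theorem differentiableAt_S {p : ℝ} (hp1 : |p| < 1) (a : ℤ) (x : ℝ) :
    DifferentiableAt ℝ (fun l : ℝ => S p l a) x := by
  have h1 := (hasDerivAt_comp_affine (c := 4 * a) (d := 0) (x := x)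
    (differentiable_theta1 hp1 _).hasDerivAt).differentiableAt
  have h4 := (hasDerivAt_comp_affine (c := 2 * a) (d := 0) (x := x)
    (differentiable_theta4 hp1 _).hasDerivAt).differentiableAt
  simp only [add_zero] at h1 h4
  exact (h1.const_mul _).div h4 (theta4_real_ne_zero hp1 (by simp [Complex.mul_im]))

theorem differentiableAt_theta4_div {p : ℝ} (hp1 : |p| < 1) (c d : ℤ) (x : ℝ) :
    DifferentiableAt ℝ (fun l : ℝ => theta4 p (c * l) / theta4 p (d * l)) x := by
  have h1 := (hasDerivAt_comp_affine (c := c) (d := 0) (x := x)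
    (differentiable_theta4 hp1 _).hasDerivAt).differentiableAt
  have h4 := (hasDerivAt_comp_affine (c := d) (d := 0) (x := x)
    (differentiable_theta4 hp1 _).hasDerivAt).differentiableAt
  simp only [add_zero] at h1 h4
  exact h1.div h4 (theta4_real_ne_zero hp1 (by simp [Complex.mul_im]))

/-- Over the denominator `θ₁(3l) θ₁(cl)`, with `cλ = kπ`, the numerator is `θ₁(3l-u) θ₁(cl+u) +
(S(a)/S(b)) θ₁(u) θ₁((c-3)l+u)`. At `l = λ` quasi-periodicity and oddness turn the second product of
theta functions into minus the first, so `S(a) = S(b)` makes the numerator vanish. -/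
theorem tendsto_rawWeight_flip {p lam : ℝ} (hp : p ≠ 0) (hp1 : |p| < 1)
    (h3 : theta1 p (3 * lam) ≠ 0) {a b k : ℤ} (hab : |a - b| = 1)
    (hk : ((a - b) * 4 * b + 2) * lam = k * Real.pi) (hS : S p lam a = S p lam b)
    (hSb : S p lam b ≠ 0) :
    (∀ᶠ l : ℝ in 𝓝[≠] lam, theta1 p ((a - b) * 4 * b * l + 2 * l) ≠ 0) ∧
    ∀ u : ℂ, ∃ w, Tendsto (fun l : ℝ => rawWeight p l a b a b u) (𝓝[≠] lam) (𝓝 w) ∧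
      (u = 3 * lam → w = 1) := by
  obtain ⟨κ, hκ, hκ0⟩ := hasDerivAt_theta1_zero hp1
  have hκ0 := hκ0 hp
  obtain ⟨c, hc⟩ : ∃ c : ℂ, c = (a - b) * 4 * b + 2 := ⟨_, rfl⟩
  -- The integer `4(a-b)b + 2` is `2` modulo `4`.
  have hc0 : c ≠ 0 := by
    have : (a - b) * 4 * b + 2 ≠ 0 := by
      rcases (abs_eq one_pos.le).1 hab with h | h <;> rw [h] <;> omega
    rw [hc]; exact_mod_cast this
  have hck : c * lam = k * Real.pi := by
    rw [hc]; exact_mod_cast congrArg (fun x : ℝ => (x : ℂ)) hk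
  have e1 : ∀ (l : ℝ) (u : ℂ), (a - b) * 4 * b * l + 2 * l + u = c * l + u := fun l u => by
    rw [hc]; ring
  have e2 : ∀ (l : ℝ) (u : ℂ), (a - b) * 4 * b * l - l + u = (c - 3) * l + u := fun l u => by
    rw [hc]; ring
  have e3 : ∀ l : ℝ, ((a : ℂ) - b) * 4 * b * l + 2 * l = c * l + 0 := fun l => by
    rw [hc]; ring
  have hε : ((-1 : ℂ) ^ k) ≠ 0 := zpow_ne_zero _ (by norm_num)
  have hmid : HasDerivAt (fun l : ℝ => theta1 p (c * l + 0)) (c * ((-1) ^ k * κ)) lam := by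
    refine hasDerivAt_comp_affine ?_
    rw [add_zero, hck]
    exact hasDerivAt_theta1_int_mul_pi hκ k
  have hm0 : theta1 p (c * lam + 0) = 0 := by
    have := theta1_add_int_mul_pi p 0 k
    rw [zero_add, theta1_zero, mul_zero] at this
    rw [add_zero, hck, this]
  have hmid0 : c * ((-1) ^ k * κ) ≠ 0 := mul_ne_zero hc0 (mul_ne_zero hε hκ0)
  refine ⟨by simpa only [e3] using hmid.eventually_ne hmid0, fun u => ?_⟩
  have ht1 : ∀ z, HasDerivAt (theta1 p) (deriv (theta1 p) z) z := fun z =>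
    (differentiable_theta1 hp1 z).hasDerivAt
  have hshift : ∀ u : ℂ, theta1 p (c * lam + u) = (-1) ^ k * theta1 p u := fun u => by
    rw [hck, add_comm, theta1_add_int_mul_pi]
  have hR := ((differentiableAt_S hp1 a lam).div (differentiableAt_S hp1 b lam) hSb).hasDerivAt
  have hN := ((hasDerivAt_comp_affine (c := 3) (d := -u) (x := lam) (ht1 _)).mul
    (hasDerivAt_comp_affine (c := c) (d := u) (x := lam) (ht1 _))).add
    (hR.mul ((hasDerivAt_comp_affine (c := c - 3) (d := u) (x := lam) (ht1 _)).const_mul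
      (theta1 p u)))
  have hD := (hasDerivAt_comp_affine (c := 3) (d := 0) (x := lam) (ht1 _)).mul hmid
  have hD' : 3 * deriv (theta1 p) (3 * lam + 0) * theta1 p (c * lam + 0) +
      theta1 p (3 * lam + 0) * (c * ((-1) ^ k * κ)) = theta1 p (3 * lam) * (c * ((-1) ^ k * κ)) := by
    rw [hm0, add_zero]; ring
  rw [hD'] at hD
  have hlim := tendsto_div_of_hasDerivAt hN hD ?_ ?_ (mul_ne_zero h3 hmid0)
  · refine ⟨_, hlim.congr fun l => ?_, fun hu => ?_⟩
    · rw [rawWeight_flip p l hab, e1, e2, e3]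
      simp only [Pi.add_apply, Pi.mul_apply, Pi.div_apply, sub_eq_add_neg, add_zero]
      ring
    · subst hu
      -- With `κ = θ₁'(0)`, the two products contribute `3` and `c - 3` times `(-1)^k κ θ₁(3λ)`,
      -- which add up to the derivative of the denominator. The derivative of `S(a)/S(b)` drops out,
      -- being multiplied by `θ₁(kπ) = 0`.
      have f1 : deriv (theta1 p) (3 * lam + -(3 * lam)) = κ := by
        rw [add_neg_cancel]; exact hκ.deriv
      have f3 : deriv (theta1 p) ((c - 3) * lam + 3 * lam) = (-1) ^ k * κ := by
        rw [show (c - 3) * lam + 3 * lam = (k : ℂ) * Real.pi by rw [← hck]; ring]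
        exact (hasDerivAt_theta1_int_mul_pi hκ k).deriv
      have f4 : theta1 p ((c - 3) * lam + 3 * lam) = 0 := by
        rw [← hm0]; congr 1; ring
      simp only [Pi.div_apply]
      rw [div_eq_one_iff_eq (mul_ne_zero h3 hmid0), f1, f3, f4, hshift, add_neg_cancel, theta1_zero,
        hS, div_self hSb]
      ring
  · have f2 : theta1 p ((c - 3) * lam + u) = -((-1) ^ k * theta1 p (3 * lam + -u)) := by
      rw [← mul_neg, ← theta1_neg, ← hshift]; congr 1; ring
    simp only [Pi.add_apply, Pi.mul_apply, Pi.div_apply]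
    rw [hshift, f2, hS, div_self hSb]
    ring
  · simp only [Pi.mul_apply, hm0, mul_zero]

/-- When `6λ = π`, `θ₁(6λ-u) = θ₁(u)` and `θ₁(3λ+u) = θ₁(3λ-u)`, so the numerator vanishes exactly
because the bracket `hC` is `1`. At `u = 3λ` its two products contribute `-3κ θ₁(3λ)` each, matching
`-6κ θ₁(3λ)` from the denominator. -/
theorem tendsto_rawWeight_const {p lam : ℝ} (hp : p ≠ 0) (hp1 : |p| < 1)
    (h3 : theta1 p (3 * lam) ≠ 0) {a : ℤ} (h6 : 6 * lam = Real.pi) (hSa : S p lam a ≠ 0)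
    (hC : S p lam (a + 1) / S p lam a *
        (theta4 p (2 * a * lam - 5 * lam) / theta4 p (2 * a * lam + lam)) +
      S p lam (a - 1) / S p lam a *
        (theta4 p (2 * a * lam + 5 * lam) / theta4 p (2 * a * lam - lam)) = 1) :
    (∀ᶠ l : ℝ in 𝓝[≠] lam, theta1 p (6 * l) ≠ 0) ∧
    ∀ u : ℂ, ∃ w, Tendsto (fun l : ℝ => rawWeight p l a a a a u) (𝓝[≠] lam) (𝓝 w) ∧
      (u = 3 * lam → w = 1) := by
  obtain ⟨κ, hκ, hκ0⟩ := hasDerivAt_theta1_zero hp1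
  have hκ0 := hκ0 hp
  have h6 : (6 * lam : ℂ) = (1 : ℤ) * Real.pi := by
    rw [← h6]; push_cast; ring
  have hκ1 := hasDerivAt_theta1_int_mul_pi hκ 1
  rw [← h6, zpow_one] at hκ1
  have hmid : HasDerivAt (fun l : ℝ => theta1 p (6 * l + 0)) (6 * (-1 * κ)) lam := by
    refine hasDerivAt_comp_affine ?_
    rwa [add_zero]
  have hshift : ∀ u : ℂ, theta1 p (6 * lam + u) = -theta1 p u := fun u => by
    rw [h6, add_comm, theta1_add_int_mul_pi]; ring
  have hm0 : theta1 p (6 * lam + 0) = 0 := by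
    rw [hshift, theta1_zero, neg_zero]
  have hmid0 : (6 * (-1 * κ)) ≠ 0 := by simpa using hκ0
  refine ⟨by simpa only [add_zero] using hmid.eventually_ne hmid0, fun u => ?_⟩
  have ht1 : ∀ z, HasDerivAt (theta1 p) (deriv (theta1 p) z) z := fun z =>
    (differentiable_theta1 hp1 z).hasDerivAt
  obtain ⟨R, hRdef⟩ : ∃ R : ℝ → ℂ, R = fun l : ℝ => S p l (a + 1) / S p l a *
        (theta4 p (2 * a * l - 5 * l) / theta4 p (2 * a * l + l)) +
      S p l (a - 1) / S p l a *
        (theta4 p (2 * a * l + 5 * l) / theta4 p (2 * a * l - l)) := ⟨_, rfl⟩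
  have hR1 : R lam = 1 := by rw [hRdef]; exact hC
  have hR : HasDerivAt R (deriv R lam) lam := by
    refine DifferentiableAt.hasDerivAt ?_
    have g1 := differentiableAt_theta4_div hp1 (2 * a - 5) (2 * a + 1) lam
    have g2 := differentiableAt_theta4_div hp1 (2 * a + 5) (2 * a - 1) lam
    push_cast at g1 g2
    simp only [sub_mul, add_mul, one_mul] at g1 g2
    rw [hRdef]
    exact (((differentiableAt_S hp1 (a + 1) lam).div (differentiableAt_S hp1 a lam) hSa).mul g1).add
      (((differentiableAt_S hp1 (a - 1) lam).div (differentiableAt_S hp1 a lam) hSa).mul g2)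
  have hN := ((hasDerivAt_comp_affine (c := 6) (d := -u) (x := lam) (ht1 _)).mul
    (hasDerivAt_comp_affine (c := 3) (d := u) (x := lam) (ht1 _))).sub
    (hR.mul ((hasDerivAt_comp_affine (c := 3) (d := -u) (x := lam) (ht1 _)).const_mul
      (theta1 p u)))
  have hD := hmid.mul (hasDerivAt_comp_affine (c := 3) (d := 0) (x := lam) (ht1 _))
  have hD' : 6 * (-1 * κ) * theta1 p (3 * lam + 0) +
      theta1 p (6 * lam + 0) * (3 * deriv (theta1 p) (3 * lam + 0)) =
        6 * (-1 * κ) * theta1 p (3 * lam) := by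
    rw [hm0, add_zero]; ring
  rw [hD'] at hD
  have hlim := tendsto_div_of_hasDerivAt hN hD ?_ ?_ (mul_ne_zero hmid0 h3)
  · refine ⟨_, hlim.congr fun l => ?_, fun hu => ?_⟩
    · rw [rawWeight_const, hRdef]
      simp only [Pi.sub_apply, Pi.mul_apply, sub_eq_add_neg, add_zero]
      ring
    · subst hu
      have f1 : deriv (theta1 p) (3 * lam + -(3 * lam)) = κ := by
        rw [add_neg_cancel]; exact hκ.deriv
      have f2 : (3 * lam + 3 * lam : ℂ) = 6 * lam := by ring
      have f3 : (6 * lam + -(3 * lam) : ℂ) = 3 * lam := by ring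
      rw [add_zero] at hm0
      rw [div_eq_one_iff_eq (mul_ne_zero hmid0 h3), f1, f2, f3, hR1, hκ1.deriv, hm0,
        add_neg_cancel, theta1_zero]
      ring
  · have f1 : theta1 p (3 * lam + u) = theta1 p (3 * lam + -u) := by
      rw [show (3 * lam + u : ℂ) = 6 * lam + -(3 * lam + -u) by ring, hshift, theta1_neg, neg_neg]
    simp only [Pi.sub_apply, Pi.mul_apply]
    rw [hshift, theta1_neg, f1, hR1]
    ring
  · simp only [Pi.mul_apply, hm0, zero_mul]

namespace Regime

variable {L K : ℕ} {p lam : ℝ}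

/-- For `L = 2` each spin has a single other neighbour: the term outside the diagram vanishes by
`S(0) = S(3) = 0`. In the other term `S(1) = S(2)`, and the `θ₄` quotient is `1` by evenness or by
the period `6λ = π`. -/
theorem const_coefficient_eq_one (h : Regime L K p lam) (hL : L = 2) (h6 : 6 * lam = Real.pi)
    {a : ℤ} (ha : 1 ≤ a ∧ a ≤ L) :
    S p lam (a + 1) / S p lam a *
        (theta4 p (2 * a * lam - 5 * lam) / theta4 p (2 * a * lam + lam)) +
      S p lam (a - 1) / S p lam a *
        (theta4 p (2 * a * lam + 5 * lam) / theta4 p (2 * a * lam - lam)) = 1 := by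
  subst hL
  have hS : S p lam 1 = S p lam 2 := h.S_reflect even_two (by norm_num)
  have hS2 : S p lam 2 ≠ 0 := h.S_ne_zero (by norm_num) (by norm_num)
  have hS3 : S p lam 3 = 0 := by simpa using h.S_last
  have h4 : theta4 p (3 * lam) ≠ 0 := theta4_real_ne_zero h.abs_nome_lt_one (by simp)
  have h6 : (6 * lam : ℂ) = Real.pi := by rw [← h6]; push_cast; ring
  obtain rfl | rfl : a = 1 ∨ a = 2 := by omega
  · have e1 : (2 * ((1 : ℤ) : ℂ) * lam - 5 * lam) = -(3 * lam) := by push_cast; ring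
    have e2 : (2 * ((1 : ℤ) : ℂ) * lam + lam) = 3 * lam := by push_cast; ring
    rw [e1, e2, theta4_neg, div_self h4, sub_self, S_zero, one_add_one_eq_two, hS, div_self hS2]
    ring
  · have e1 : (2 * ((2 : ℤ) : ℂ) * lam + 5 * lam) = 3 * lam + Real.pi := by
      rw [← h6]; push_cast; ring
    have e2 : (2 * ((2 : ℤ) : ℂ) * lam - lam) = 3 * lam := by push_cast; ring
    rw [e1, e2, theta4_add_pi, div_self h4, show (2 : ℤ) + 1 = 3 by norm_num,
      show (2 : ℤ) - 1 = 1 by norm_num, hS3, hS, div_self hS2]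
    ring

/-- At an exceptional face the singularity in the crossing parameter is isolated and removable,
and the limiting weight at `u = 3 λ` is the one given by crossing symmetry. -/
theorem tendsto_rawWeight_of_exceptional (h : Regime L K p lam) {a b c d : ℤ}
    (ha : 1 ≤ a ∧ a ≤ L) (hb : 1 ≤ b ∧ b ≤ L) (hE : Exceptional p lam a b c d) :
    (∀ᶠ l : ℝ in 𝓝[≠] lam, ¬ Exceptional p l a b c d) ∧
    ∀ u : ℂ, ∃ w, Tendsto (fun l : ℝ => rawWeight p l a b c d u) (𝓝[≠] lam) (𝓝 w) ∧
      (u = 3 * lam → w = if b = d then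
        root (S p lam a / S p lam b) * root (S p lam c / S p lam b) else 0) := by
  rcases hE with ⟨rfl, rfl, rfl, h6⟩ | ⟨rfl, rfl, hab, h7⟩
  · obtain ⟨hL, hpi⟩ := h.eq_of_theta1_six_mul_eq_zero h6
    obtain ⟨he, ht⟩ := tendsto_rawWeight_const h.nome_ne_zero h.abs_nome_lt_one
      h.theta1_three_mul_ne_zero hpi (h.S_ne_zero ha.1 ha.2)
      (h.const_coefficient_eq_one hL hpi ha)
    refine ⟨he.mono fun l hl hE => ?_, ?_⟩
    · rcases hE with hE | hE
      · exact hl hE.2.2.2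
      · simp at hE
    · simpa only [if_true, h.root_self ha.1 ha.2, mul_one] using ht
  · obtain ⟨hL, hsum, k, hk⟩ := h.eq_of_theta1_mid_eq_zero ha.1 ha.2 hb.1 hb.2
      ((abs_eq one_pos.le).1 hab) h7
    have hS := h.S_reflect hL hsum
    obtain ⟨he, ht⟩ := tendsto_rawWeight_flip h.nome_ne_zero h.abs_nome_lt_one
      h.theta1_three_mul_ne_zero hab hk hS (h.S_ne_zero hb.1 hb.2)
    refine ⟨he.mono fun l hl hE => ?_, ?_⟩
    · rcases hE with hE | hE
      · exact ne_of_abs_sub_eq_one hab hE.1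
      · exact hl hE.2.2.2
    · simpa only [if_true, hS, h.root_self hb.1 hb.2, mul_one] using ht

end Regime

/-! ### The adjacency graph -/

section Graph

variable {L : ℕ}

theorem sum_site (f : ℤ → ℤ) : ∑ c : Site L, f c = ∑ c ∈ Finset.Icc (1 : ℤ) L, f c :=
  (Finset.sum_subtype _ (fun x => by simp) f).symm

theorem one_add_dynkin_apply (a b : Site L) :
    (1 + dynkin L) a b = if |(a : ℤ) - b| ≤ 1 then 1 else 0 := by
  have h1 : |(a : ℤ) - b| ≤ 1 ↔ (a : ℤ) = b ∨ |(a : ℤ) - b| = 1 := by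
    rw [abs_le, abs_eq one_pos.le]; omega
  by_cases hab : a = b
  · subst hab; simp [dynkin]
  · have : (a : ℤ) ≠ b := fun h => hab (Subtype.ext h)
    simp [dynkin, hab, h1, this]

theorem adjacent_iff (a b : Site L) : Adjacent L a b ↔ |(a : ℤ) - b| ≤ 1 := by
  rw [Adjacent, fusedAdj, one_add_dynkin_apply]
  simp

theorem valence_eq (a : Site L) :
    valence L a = min (L : ℤ) (a + 1) + 1 - max 1 ((a : ℤ) - 1) := by
  have h1 : valence L a = ∑ b : Site L, if |(a : ℤ) - b| ≤ 1 then 1 else 0 :=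
    Finset.sum_congr rfl fun b _ => by
      rw [← one_add_dynkin_apply, Matrix.add_apply, Matrix.one_apply]
  have h2 : (Finset.Icc (1 : ℤ) L).filter (fun b => |(a : ℤ) - b| ≤ 1) =
      Finset.Icc (max 1 ((a : ℤ) - 1)) (min (L : ℤ) (a + 1)) := by
    ext b; simp only [Finset.mem_filter, Finset.mem_Icc, abs_le]; omega
  obtain ⟨ha1, ha2⟩ := a.2
  rw [h1, sum_site fun b => if |(a : ℤ) - b| ≤ 1 then 1 else 0, Finset.sum_boole, h2,
    Int.card_Icc, Int.toNat_of_nonneg (by omega)]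

/-- The recursion gives `(I + A)² - I`: the number of common neighbours, which form an interval,
less `1` on the diagonal. The `max 0` accounts for an empty interval. -/
theorem fusedAdj_two (a b : Site L) : fusedAdj L 2 a b =
    max 0 (min (L : ℤ) (min ((a : ℤ) + 1) (b + 1)) + 1 - max 1 (max ((a : ℤ) - 1) (b - 1))) -
      if (a : ℤ) = b then 1 else 0 := by
  have h1 : fusedAdj L 2 a b = (∑ c : Site L, if |(a : ℤ) - c| ≤ 1 ∧ |(c : ℤ) - b| ≤ 1 then 1 else 0)
      - if (a : ℤ) = b then 1 else 0 := by
    change ((1 + dynkin L) * (1 + dynkin L) - 1) a b = _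
    rw [Matrix.sub_apply, Matrix.mul_apply, Matrix.one_apply]
    simp only [one_add_dynkin_apply, ite_and, Subtype.ext_iff, ite_mul, one_mul, zero_mul]
  have h2 : (Finset.Icc (1 : ℤ) L).filter (fun c => |(a : ℤ) - c| ≤ 1 ∧ |c - (b : ℤ)| ≤ 1) =
      Finset.Icc (max 1 (max ((a : ℤ) - 1) (b - 1))) (min (L : ℤ) (min ((a : ℤ) + 1) (b + 1))) := by
    ext c; simp only [Finset.mem_filter, Finset.mem_Icc, abs_le]; omega
  rw [h1, sum_site fun c => if |(a : ℤ) - c| ≤ 1 ∧ |c - (b : ℤ)| ≤ 1 then 1 else 0,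
    Finset.sum_boole, h2, Int.card_Icc, Int.toNat_eq_max, max_comm]

theorem valence_eq_three_iff (a : Site L) :
    valence L a = 3 ↔ 2 ≤ (a : ℤ) ∧ (a : ℤ) + 1 ≤ L := by
  obtain ⟨ha1, ha2⟩ := a.2
  rw [valence_eq]; omega

theorem valence_eq_two_iff (hL : 2 ≤ L) (a : Site L) :
    valence L a = 2 ↔ (a : ℤ) = 1 ∨ (a : ℤ) = L := by
  obtain ⟨ha1, ha2⟩ := a.2
  rw [valence_eq]; omega

theorem fusedAdj_two_cases (hL : 2 ≤ L) (a b : Site L) :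
    ((a : ℤ) = b ∧ valence L a = 3 ∧ fusedAdj L 2 a b = 2) ∨
    ((a : ℤ) = b ∧ valence L a = 2 ∧ fusedAdj L 2 a b = 1) ∨
    (((a : ℤ) = b + 1 ∨ (a : ℤ) = b - 1) ∧ fusedAdj L 2 a b = 2) ∨
    (((a : ℤ) = b + 2 ∨ (a : ℤ) = b - 2) ∧ fusedAdj L 2 a b = 1) ∨
    (((a : ℤ) > b + 2 ∨ (a : ℤ) < b - 2) ∧ fusedAdj L 2 a b = 0) := by
  obtain ⟨ha1, ha2⟩ := a.2
  obtain ⟨hb1, hb2⟩ := b.2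
  rw [fusedAdj_two, valence_eq]
  split_ifs <;> omega

theorem bonds_eq_of_fusedAdj_one {a b : Site L} (h : fusedAdj L 2 a b = 1) : bonds L a b = {1} := by
  rw [bonds, h, Finset.Icc_self]

theorem bonds_eq_of_fusedAdj_two {a b : Site L} (h : fusedAdj L 2 a b = 2) :
    bonds L a b = {1, 2} := by
  rw [bonds, h]; rfl

theorem admissible_edges (hL : 2 ≤ L) (a b : Site L) :
    (fusedAdj L 2 a b ≠ 0 ↔ |(a : ℤ) - b| ≤ 2) ∧
      (|(a : ℤ) - b| = 2 ∨ (a = b ∧ valence L a = 2) → bonds L a b = {1}) ∧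
      (|(a : ℤ) - b| = 1 ∨ (a = b ∧ valence L a = 3) → bonds L a b = {1, 2}) ∧
      (valence L a = 2 ∨ valence L a = 3) := by
  have hc := fusedAdj_two_cases hL a b
  have hv : valence L a = 2 ∨ valence L a = 3 := by
    obtain ⟨ha1, ha2⟩ := a.2
    rw [valence_eq_two_iff hL, valence_eq_three_iff]; omega
  refine ⟨by rw [abs_le]; omega, fun h => bonds_eq_of_fusedAdj_one ?_,
    fun h => bonds_eq_of_fusedAdj_two ?_, hv⟩
  · rw [abs_eq two_pos.le, Subtype.ext_iff] at h; omega
  · rw [abs_eq one_pos.le, Subtype.ext_iff] at h; omega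

end Graph

/-! ### The face weights at `u = 0` and `u = 3 λ` -/

section FaceWeight

variable {L K : ℕ} {p lam : ℝ}

theorem faceWeight_eq_zero {a b c d : Site L}
    (hadj : ¬ (Adjacent L a b ∧ Adjacent L b c ∧ Adjacent L c d ∧ Adjacent L d a)) (u : ℂ) :
    faceWeight L p lam a b c d u = 0 := by
  rw [faceWeight, if_neg hadj]

theorem Regime.tendsto_faceWeight (h : Regime L K p lam) {a b c d : Site L}
    (hab : Adjacent L a b) (hbc : Adjacent L b c) (hcd : Adjacent L c d) (hda : Adjacent L d a)
    (hE : Exceptional p lam a b c d) (u : ℂ) :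
    Tendsto (fun l : ℝ => rawWeight p l a b c d u) (𝓝[≠] lam)
      (𝓝 (faceWeight L p lam a b c d u)) := by
  obtain ⟨w, hw, -⟩ := (h.tendsto_rawWeight_of_exceptional a.2 b.2 hE).2 u
  rw [faceWeight, if_pos ⟨hab, hbc, hcd, hda⟩, if_pos hE, hw.limUnder_eq]
  exact hw

theorem Regime.faceWeight_zero (h : Regime L K p lam) {a b c d : Site L}
    (hab : Adjacent L a b) (hbc : Adjacent L b c) (hcd : Adjacent L c d) (hda : Adjacent L d a) :
    faceWeight L p lam a b c d 0 = if (a : ℤ) = c then 1 else 0 := by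
  have hab' := (adjacent_iff _ _).1 hab
  have hbc' := (adjacent_iff _ _).1 hbc
  have hcd' := (adjacent_iff _ _).1 hcd
  have hda' := (adjacent_iff _ _).1 hda
  by_cases hE : Exceptional p lam a b c d
  · have ht := h.tendsto_faceWeight hab hbc hcd hda hE 0
    -- The exceptional parameter is isolated, so near it the explicit weight at `u = 0` is already
    -- constant in `l`.
    refine tendsto_nhds_unique ht (tendsto_const_nhds.congr' ?_)
    have hne : ∀ c : ℂ, theta1 p (c * lam) ≠ 0 →
        ∀ᶠ l : ℝ in 𝓝[≠] lam, theta1 p (c * l) ≠ 0 := fun c hc => by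
      have hcont : Continuous fun l : ℝ => theta1 p (c * l) :=
        (differentiable_theta1 h.abs_nome_lt_one).continuous.comp (by fun_prop)
      exact (hcont.continuousAt.eventually_ne hc).filter_mono nhdsWithin_le_nhds
    filter_upwards [(h.tendsto_rawWeight_of_exceptional a.2 b.2 hE).1,
      hne 2 h.theta1_two_mul_ne_zero, hne 3 h.theta1_three_mul_ne_zero] with l hl h2 h3
    exact (rawWeight_zero h.abs_nome_lt_one h2 h3 hab' hbc' hcd' hda' hl).symm
  · rw [faceWeight, if_pos ⟨hab, hbc, hcd, hda⟩, if_neg hE]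
    exact rawWeight_zero h.abs_nome_lt_one h.theta1_two_mul_ne_zero h.theta1_three_mul_ne_zero
      hab' hbc' hcd' hda' hE

theorem Regime.faceWeight_three_mul (h : Regime L K p lam) {a b c d : Site L}
    (hab : Adjacent L a b) (hbc : Adjacent L b c) (hcd : Adjacent L c d) (hda : Adjacent L d a) :
    faceWeight L p lam a b c d (3 * lam) = if (b : ℤ) = d then
      root (S p lam a / S p lam b) * root (S p lam c / S p lam b) else 0 := by
  by_cases hE : Exceptional p lam a b c d
  · obtain ⟨w, hw, hw'⟩ := (h.tendsto_rawWeight_of_exceptional a.2 b.2 hE).2 (3 * lam)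
    rw [← hw' rfl]
    exact tendsto_nhds_unique (h.tendsto_faceWeight hab hbc hcd hda hE _) hw
  · rw [faceWeight, if_pos ⟨hab, hbc, hcd, hda⟩, if_neg hE]
    exact h.rawWeight_three_mul a.2 b.2 c.2 ((adjacent_iff _ _).1 hab) ((adjacent_iff _ _).1 hbc)
      ((adjacent_iff _ _).1 hcd) ((adjacent_iff _ _).1 hda) hE

end FaceWeight

/-! ### The fusion coefficients -/

section Phi

variable {L K : ℕ} {p lam : ℝ}

theorem phi_self_one {a : Site L} (hv : valence L a = 3) (a' : Site L) :
    phi L p lam 1 a a' a = (-1 : ℂ) ^ ((a : ℤ) + 1 - a') * (if 0 ≤ (a' : ℤ) - a then 1 else 0) *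
      root (S p lam (a + 1) / S p lam a') := by
  rw [phi, if_pos ⟨rfl, rfl, hv⟩]

theorem phi_self_two {a : Site L} (hv : valence L a = 3) (a' : Site L) :
    phi L p lam 2 a a' a = (-1 : ℂ) ^ ((a : ℤ) - 1 - a') * (if 0 ≤ (a : ℤ) - a' then 1 else 0) *
      root (S p lam (a - 1) / S p lam a') := by
  rw [phi, if_neg (by simp), if_pos ⟨rfl, rfl, hv⟩]

theorem phi_self_end {a : Site L} (hv : valence L a = 2) (α : ℤ) (a' : Site L) :
    phi L p lam α a a' a = (-1 : ℂ) ^ ((a : ℤ) - a') * root (S p lam a / S p lam a') := by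
  rw [phi, if_neg (by omega), if_neg (by omega), if_pos ⟨rfl, hv⟩]

theorem phi_of_ne {a b : Site L} (hab : (a : ℤ) ≠ b) (α : ℤ) (a' : Site L) :
    phi L p lam α a a' b =
      if (a : ℤ) = b - 1 then if (a' : ℤ) = a + α - 1 then 1 else 0
      else if (a : ℤ) = b + 1 then if (a' : ℤ) = b + α - 1 then 1 else 0
      else if |(a : ℤ) - b| = 2 then if 2 * (a' : ℤ) = a + b ∧ α = 1 then 1 else 0
      else 0 := by
  have : a ≠ b := fun h => hab (by rw [h])
  rw [phi, if_neg (fun h => this h.1), if_neg (fun h => this h.1), if_neg (fun h => this h.1)]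

theorem Regime.root_S_ne_zero (h : Regime L K p lam) {a b : ℤ} (ha : 1 ≤ a ∧ a ≤ L)
    (hb : 1 ≤ b ∧ b ≤ L) : root (S p lam a / S p lam b) ≠ 0 :=
  root_ne_zero (div_ne_zero (h.S_ne_zero ha.1 ha.2) (h.S_ne_zero hb.1 hb.2))

/-- This is the cancellation behind the fusion: the diagonal `φ^α` are orthogonal to the vector
`S(a')^{1/2}` on the neighbours of `a`. The cutoff `|a - a'| ≤ 1` is needed, since `φ` does not
vanish at distant `a'`; in the fused weight the faces supply it. -/
theorem Regime.sum_phi_self (h : Regime L K p lam) {a : Site L} {α : ℤ} (hα : α ∈ bonds L a a) :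
    ∑ a' : Site L, phi L p lam α a a' a *
      (if |(a : ℤ) - a'| ≤ 1 then root (S p lam a' / S p lam a) else 0) = 0 := by
  have hL := h.two_le
  obtain ⟨-, hb2, hb3, hv⟩ := admissible_edges hL a a
  have hr : ∀ b c : Site L, root (S p lam b / S p lam c) * root (S p lam c / S p lam a) =
      root (S p lam b / S p lam a) := fun b c =>
    h.root_mul_root b.2.1 b.2.2 c.2.1 c.2.2 a.2.1 a.2.2
  -- Only `a` and one further neighbour `b` matter: the unique one at an end of the diagram, and
  -- otherwise the one kept by the step function `θ`.
  have hsum : ∀ b : Site L, (b : ℤ) = a + 1 ∨ (b : ℤ) = a - 1 →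
      (∀ x : Site L, (x : ℤ) ≠ a → (x : ℤ) ≠ b → |(a : ℤ) - x| ≤ 1 → phi L p lam α a x a = 0) →
      phi L p lam α a a a * root (S p lam a / S p lam a) +
        phi L p lam α a b a * root (S p lam b / S p lam a) = 0 →
      ∑ a' : Site L, phi L p lam α a a' a *
        (if |(a : ℤ) - a'| ≤ 1 then root (S p lam a' / S p lam a) else 0) = 0 := by
    intro b hb hx hab
    have hne : a ≠ b := fun h => by rw [← h] at hb; omega
    rw [Fintype.sum_eq_add a b hne fun x hx' => ?_]
    · rw [if_pos (by simp), if_pos (by rw [abs_le]; omega)]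
      exact hab
    · split_ifs with h1
      · rw [hx x (fun h => hx'.1 (Subtype.ext h)) (fun h => hx'.2 (Subtype.ext h)) h1, zero_mul]
      · rw [mul_zero]
  rcases hv with hv | hv
  · have hb : ∃ b : Site L, ((b : ℤ) = a + 1 ∨ (b : ℤ) = a - 1) ∧
        ∀ x : Site L, |(a : ℤ) - x| ≤ 1 → (x : ℤ) = a ∨ (x : ℤ) = b := by
      have ha := a.2
      rcases (valence_eq_two_iff hL a).1 hv with h1 | h1
      · refine ⟨⟨2, by constructor <;> omega⟩, by dsimp only; omega, fun x hx => ?_⟩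
        have := x.2.1
        rw [abs_le] at hx; dsimp only; omega
      · refine ⟨⟨L - 1, by constructor <;> omega⟩, by dsimp only; omega, fun x hx => ?_⟩
        have := x.2.2
        rw [abs_le] at hx; dsimp only; omega
    obtain ⟨b, hb, hx⟩ := hb
    refine hsum b hb (fun x h1 h2 h3 => absurd (hx x h3) (by tauto)) ?_
    rw [phi_self_end hv, phi_self_end hv, mul_assoc, mul_assoc, hr, hr,
      sub_self, zpow_zero]
    have : (-1 : ℂ) ^ ((a : ℤ) - b) = -1 := by
      rcases hb with hb | hb <;> rw [hb]
      · rw [show (a : ℤ) - (a + 1) = -1 by ring]; norm_num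
      · rw [show (a : ℤ) - (a - 1) = 1 by ring]; norm_num
    rw [this]; ring
  · have ha := (valence_eq_three_iff a).1 hv
    have hα : α = 1 ∨ α = 2 := by simpa [hb3 (.inr ⟨rfl, hv⟩)] using hα
    rcases hα with rfl | rfl
    · obtain ⟨b, hb⟩ : ∃ b : Site L, (b : ℤ) = a + 1 :=
        ⟨⟨a + 1, by constructor <;> omega⟩, rfl⟩
      refine hsum b (.inl hb) (fun x h1 h2 h3 => ?_) ?_
      · rw [abs_le] at h3
        rw [phi_self_one hv, if_neg (by omega)]; ring
      · rw [phi_self_one hv, phi_self_one hv, if_pos (by omega), if_pos (by omega), ← hb, sub_self,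
          show (b : ℤ) - a = 1 by omega]
        simp only [mul_one, mul_assoc, hr]
        norm_num
    · obtain ⟨b, hb⟩ : ∃ b : Site L, (b : ℤ) = a - 1 :=
        ⟨⟨a - 1, by constructor <;> omega⟩, rfl⟩
      refine hsum b (.inr hb) (fun x h1 h2 h3 => ?_) ?_
      · rw [abs_le] at h3
        rw [phi_self_two hv, if_neg (by omega)]; ring
      · rw [phi_self_two hv, phi_self_two hv, if_pos (by omega), if_pos (by omega), ← hb, sub_self,
          show (b : ℤ) - a = -1 by omega]
        simp only [mul_one, mul_assoc, hr]
        norm_num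

/-! ### Vanishing of the fused weights. -/

theorem Regime.fusedWeight_zero (h : Regime L K p lam) {a b c d c' : Site L} {α : ℤ}
    (hα : α ∈ bonds L a b) (hup : UpperPath L d c' c) :
    fusedWeight L p lam a b c d α c' 0 = 0 := by
  rw [fusedWeight, zero_add]
  have hsymm : ∀ x y : Site L, Adjacent L x y → Adjacent L y x := fun x y hxy => by
    rw [adjacent_iff] at hxy ⊢; rwa [abs_sub_comm]
  obtain ⟨hdc, hcc, -⟩ := hup
  -- The left face at `0` requires `c' = a` and the right face at `3λ` requires `c' = b`; the mixed
  -- cases vanish term by term.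
  by_cases hac : a = c'
  · subst hac
    by_cases hab : a = b
    · subst hab
      have hterm : ∀ a' : Site L, phi L p lam α a a' a * faceWeight L p lam a a' a d 0 *
          faceWeight L p lam a' a c a (3 * lam) = phi L p lam α a a' a *
          (if |(a : ℤ) - a'| ≤ 1 then root (S p lam a' / S p lam a) else 0) *
          root (S p lam c / S p lam a) := fun a' => by
        by_cases haa : Adjacent L a a'
        · rw [h.faceWeight_zero haa (hsymm _ _ haa) (hsymm _ _ hdc) hdc,
            h.faceWeight_three_mul (hsymm _ _ haa) hcc (hsymm _ _ hcc) haa, if_pos rfl, if_pos rfl,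
            if_pos ((adjacent_iff _ _).1 haa)]
          ring
        · rw [faceWeight_eq_zero (fun hadj => haa hadj.1),
            if_neg (fun hle => haa ((adjacent_iff _ _).2 hle))]
          ring
      rw [Finset.sum_congr rfl fun a' _ => hterm a', ← Finset.sum_mul, h.sum_phi_self hα, zero_mul]
    · refine Finset.sum_eq_zero fun a' _ => ?_
      have : faceWeight L p lam a' b c a (3 * lam) = 0 := by
        by_cases hadj : Adjacent L a' b ∧ Adjacent L b c ∧ Adjacent L c a ∧ Adjacent L a a'
        · rw [h.faceWeight_three_mul hadj.1 hadj.2.1 hadj.2.2.1 hadj.2.2.2,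
            if_neg (fun heq => hab (Subtype.ext heq).symm)]
        · exact faceWeight_eq_zero hadj _
      rw [this, mul_zero]
  · refine Finset.sum_eq_zero fun a' _ => ?_
    have : faceWeight L p lam a a' c' d 0 = 0 := by
      by_cases hadj : Adjacent L a a' ∧ Adjacent L a' c' ∧ Adjacent L c' d ∧ Adjacent L d a
      · rw [h.faceWeight_zero hadj.1 hadj.2.1 hadj.2.2.1 hadj.2.2.2,
          if_neg (fun heq => hac (Subtype.ext heq))]
      · exact faceWeight_eq_zero hadj _
    rw [this, mul_zero, zero_mul]

/-! ### Upper paths and their bond labels. -/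

theorem mem_bonds_cases (hL : 2 ≤ L) (d c : Site L) :
    ((d : ℤ) = c ∧ valence L c = 3 ∧ bonds L d c = {1, 2}) ∨
    ((d : ℤ) = c ∧ valence L c = 2 ∧ bonds L d c = {1}) ∨
    (((d : ℤ) = c + 1 ∨ (d : ℤ) = c - 1) ∧ bonds L d c = {1, 2}) ∨
    (((d : ℤ) = c + 2 ∨ (d : ℤ) = c - 2) ∧ bonds L d c = {1}) ∨
    (((d : ℤ) > c + 2 ∨ (d : ℤ) < c - 2) ∧ bonds L d c = ∅) := by
  rcases fusedAdj_two_cases hL d c with ⟨h1, h2, h3⟩ | ⟨h1, h2, h3⟩ | ⟨h1, h3⟩ | ⟨h1, h3⟩ | ⟨h1, h3⟩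
  · exact .inl ⟨h1, Subtype.ext h1 ▸ h2, bonds_eq_of_fusedAdj_two h3⟩
  · exact .inr (.inl ⟨h1, Subtype.ext h1 ▸ h2, bonds_eq_of_fusedAdj_one h3⟩)
  · exact .inr (.inr (.inl ⟨h1, bonds_eq_of_fusedAdj_two h3⟩))
  · exact .inr (.inr (.inr (.inl ⟨h1, bonds_eq_of_fusedAdj_one h3⟩)))
  · exact .inr (.inr (.inr (.inr ⟨h1, by rw [bonds, h3]; rfl⟩)))

/-- The supports of the different `φ^β` on one edge are disjoint along allowed paths. The only
overlap would be `c' = c = d` at valence three, where `φ¹` and `φ²` are both nonzero; `UpperPath`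
excludes it. -/
theorem Regime.phi_ne_zero_iff_eq_bondLabel (h : Regime L K p lam) {d c' c : Site L}
    (hup : UpperPath L d c' c) (β : ℤ) :
    (β ∈ bonds L d c ∧ phi L p lam β d c' c ≠ 0) ↔ β = bondLabel L d c' c := by
  obtain ⟨hdc, hcc, hne⟩ := hup
  rw [adjacent_iff, abs_le] at hdc hcc
  rcases mem_bonds_cases h.two_le d c with
    ⟨h1, h2, h3⟩ | ⟨h1, h2, h3⟩ | ⟨h1, h3⟩ | ⟨h1, h3⟩ | ⟨h1, h3⟩
  · obtain rfl : d = c := Subtype.ext h1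
    have hc := (valence_eq_three_iff d).1 h2
    have hne' : (c' : ℤ) ≠ d := fun heq => hne rfl h2 (Subtype.ext heq)
    have r1 : root (S p lam (d + 1) / S p lam c') ≠ 0 := h.root_S_ne_zero (by omega) c'.2
    have r2 : root (S p lam (d - 1) / S p lam c') ≠ 0 := h.root_S_ne_zero (by omega) c'.2
    have p1 : phi L p lam 1 d c' d ≠ 0 ↔ (c' : ℤ) ≠ d - 1 := by
      have : 0 ≤ (c' : ℤ) - d ↔ (c' : ℤ) ≠ d - 1 := by omega
      rw [phi_self_one h2, ← this]
      simp [r1, zpow_ne_zero]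
    have p2 : phi L p lam 2 d c' d ≠ 0 ↔ (c' : ℤ) = d - 1 := by
      have : 0 ≤ (d : ℤ) - c' ↔ (c' : ℤ) = d - 1 := by omega
      rw [phi_self_two h2, ← this]
      simp [r2, zpow_ne_zero]
    have hlab : bondLabel L d c' d = if (c' : ℤ) = d - 1 then 2 else 1 := by
      simp [bondLabel, h2]
    rw [h3, hlab, Finset.mem_insert, Finset.mem_singleton]
    constructor
    · rintro ⟨rfl | rfl, h5⟩
      · rw [if_neg (p1.1 h5)]
      · rw [if_pos (p2.1 h5)]
    · split_ifs with h5 <;> rintro rfl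
      · exact ⟨.inr rfl, p2.2 h5⟩
      · exact ⟨.inl rfl, p1.2 h5⟩
  · obtain rfl : d = c := Subtype.ext h1
    have hlab : bondLabel L d c' d = 1 := by
      simp [bondLabel, h2]
    rw [h3, hlab, Finset.mem_singleton, and_iff_left]
    rw [phi_self_end h2]
    exact mul_ne_zero (zpow_ne_zero _ (by norm_num)) (h.root_S_ne_zero d.2 c'.2)
  · have hlab : bondLabel L d c' c = if (c' : ℤ) = max (c : ℤ) d then 2 else 1 := by
      have e1 : c ≠ d := fun h => by rw [h] at h1; omega
      have e2 : |(c : ℤ) - d| = 1 := by rw [abs_eq one_pos.le]; omega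
      simp [bondLabel, e1, e2]
    rw [h3, hlab, Finset.mem_insert, Finset.mem_singleton, phi_of_ne (by omega)]
    split_ifs <;> simp <;> omega
  · have hlab : bondLabel L d c' c = 1 := by
      have e1 : c ≠ d := fun h => by rw [h] at h1; omega
      have e2 : ¬ |(c : ℤ) - d| = 1 := by rw [abs_eq one_pos.le]; omega
      simp [bondLabel, e1, e2]
    have e2 : |(d : ℤ) - c| = 2 := by rw [abs_eq two_pos.le]; omega
    rw [h3, hlab, Finset.mem_singleton, phi_of_ne (by omega), if_neg (by omega), if_neg (by omega),
      if_pos e2]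
    split_ifs
    all_goals simp
    omega
  · omega

/-- The site is `d ± 1` on the diagonal, the smaller or larger end when `|c - d| = 1`, and the
midpoint when `|c - d| = 2`. At an end with `c = d` two paths share the label `1`, hence the
exclusion. -/
theorem exists_site_of_mem_bonds (hL : 2 ≤ L) {d c : Site L} {β : ℤ} (hβ : β ∈ bonds L d c)
    (hend : ¬ (c = d ∧ valence L c = 2)) :
    ∃ x : Site L, ∀ c' : Site L, (UpperPath L d c' c ∧ bondLabel L d c' c = β) ↔ c' = x := by
  obtain ⟨hc1, hc2⟩ := c.2
  obtain ⟨hd1, hd2⟩ := d.2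
  simp only [UpperPath, adjacent_iff, abs_le, Subtype.ext_iff, ne_eq]
  rcases mem_bonds_cases hL d c with
    ⟨h1, h2, h3⟩ | ⟨h1, h2, h3⟩ | ⟨h1, h3⟩ | ⟨h1, h3⟩ | ⟨h1, h3⟩ <;> rw [h3] at hβ
  · obtain rfl : d = c := Subtype.ext h1
    have hc := (valence_eq_three_iff d).1 h2
    have hlab : ∀ c', bondLabel L d c' d = if (c' : ℤ) = d - 1 then 2 else 1 := fun c' => by
      simp [bondLabel, h2]
    rw [Finset.mem_insert, Finset.mem_singleton] at hβ
    rcases hβ with rfl | rfl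
    · refine ⟨⟨d + 1, by constructor <;> omega⟩, fun c' => ?_⟩
      simp only [hlab, h2, forall_const]
      split_ifs <;> omega
    · refine ⟨⟨d - 1, by constructor <;> omega⟩, fun c' => ?_⟩
      simp only [hlab, h2, forall_const]
      split_ifs <;> omega
  · exact absurd ⟨(Subtype.ext h1).symm, h2⟩ hend
  · have e1 : c ≠ d := fun h => by rw [h] at h1; omega
    have e2 : |(c : ℤ) - d| = 1 := by rw [abs_eq one_pos.le]; omega
    have hlab : ∀ c', bondLabel L d c' c = if (c' : ℤ) = max (c : ℤ) d then 2 else 1 := fun c' => by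
      simp [bondLabel, e1, e2]
    rw [Finset.mem_insert, Finset.mem_singleton] at hβ
    rcases hβ with rfl | rfl
    · refine ⟨⟨min (c : ℤ) d, by constructor <;> omega⟩, fun c' => ?_⟩
      simp only [hlab]
      split_ifs <;> omega
    · refine ⟨⟨max (c : ℤ) d, by constructor <;> omega⟩, fun c' => ?_⟩
      simp only [hlab]
      split_ifs <;> omega
  · have e1 : c ≠ d := fun h => by rw [h] at h1; omega
    have e2 : ¬ |(c : ℤ) - d| = 1 := by rw [abs_eq one_pos.le]; omega
    have hlab : ∀ c', bondLabel L d c' c = 1 := fun c' => by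
      simp [bondLabel, e1, e2]
    rw [Finset.mem_singleton] at hβ
    refine ⟨⟨min (c : ℤ) d + 1, by constructor <;> omega⟩, fun c' => ?_⟩
    simp only [hlab]
    omega
  · simp at hβ

theorem exists_upperPath (hL : 2 ≤ L) {d c : Site L} {β : ℤ} (hβ : β ∈ bonds L d c) :
    (∃ c' : Site L, UpperPath L d c' c ∧ bondLabel L d c' c = β) ∧
      (¬ (c = d ∧ valence L c = 2) →
        ∃! c' : Site L, UpperPath L d c' c ∧ bondLabel L d c' c = β) := by
  have key : ¬ (c = d ∧ valence L c = 2) →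
      ∃! c' : Site L, UpperPath L d c' c ∧ bondLabel L d c' c = β := fun hend => by
    obtain ⟨x, hx⟩ := exists_site_of_mem_bonds hL hβ hend
    exact ⟨x, (hx x).2 rfl, fun y hy => (hx y).1 hy⟩
  refine ⟨?_, key⟩
  by_cases hend : c = d ∧ valence L c = 2
  · obtain ⟨rfl, hv⟩ := hend
    have hβ1 : β = 1 := by
      simpa [(admissible_edges hL c c).2.1 (.inr ⟨rfl, hv⟩)] using hβ
    -- The constant path is allowed here, since `c' ≠ c` is only imposed at valence three.
    refine ⟨c, ⟨(adjacent_iff _ _).2 (by simp), (adjacent_iff _ _).2 (by simp),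
      fun _ h3 => by omega⟩, ?_⟩
    simp [bondLabel, hv, hβ1]
  · exact (key hend).exists

end Phi

end DiluteA

end

theorem lemma1 (L : ℕ) (hL : 2 ≤ L) (p lam : ℝ) (hp : p ≠ 0) (hp1 : |p| < 1)
    (hlam : lam = Real.pi / 4 * ((L + 2) / (L + 1)) ∨ lam = Real.pi / 4 * (L / (L + 1)))
    (hsin : Real.sin (3 * lam) ≠ 0) :
    -- The face weights and the coefficients are well defined: no denominator vanishes except at
    -- exceptional faces, there the singularity is removable, and all radicands are positive.
    ((DiluteA.theta1 p (2 * lam) ≠ 0 ∧ DiluteA.theta1 p (3 * lam) ≠ 0 ∧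
        (∀ x : ℝ, ∃ r : ℝ, 0 < r ∧ DiluteA.theta4 p x = r) ∧
        (∀ a b : DiluteA.Site L, ∃ r : ℝ, 0 < r ∧
          DiluteA.S p lam a ≠ 0 ∧ DiluteA.S p lam a / DiluteA.S p lam b = r)) ∧
      (∀ (a b c d : DiluteA.Site L) (u : ℂ),
        DiluteA.Adjacent L a b → DiluteA.Adjacent L b c → DiluteA.Adjacent L c d →
        DiluteA.Adjacent L d a → DiluteA.Exceptional p lam a b c d →
        Filter.Tendsto (fun l : ℝ => DiluteA.rawWeight p l a b c d u)
          (nhdsWithin lam {lam}ᶜ) (nhds (DiluteA.faceWeight L p lam a b c d u)))) ∧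
    -- The admissible edges at fusion level two and their bond variables.
    (∀ a b : DiluteA.Site L,
      (DiluteA.fusedAdj L 2 a b ≠ 0 ↔ |(a : ℤ) - b| ≤ 2) ∧
      (|(a : ℤ) - b| = 2 ∨ (a = b ∧ DiluteA.valence L a = 2) → DiluteA.bonds L a b = {1}) ∧
      (|(a : ℤ) - b| = 1 ∨ (a = b ∧ DiluteA.valence L a = 3) → DiluteA.bonds L a b = {1, 2}) ∧
      (DiluteA.valence L a = 2 ∨ DiluteA.valence L a = 3)) ∧
    -- (i) The bond label of an allowed upper path is the only bond variable of the upper edge to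
    -- which the path belongs; all bond variables occur.
    (∀ d c' c : DiluteA.Site L, DiluteA.UpperPath L d c' c →
      ∀ β : ℤ, (β ∈ DiluteA.bonds L d c ∧ DiluteA.phi L p lam β d c' c ≠ 0) ↔
        β = DiluteA.bondLabel L d c' c) ∧
    (∀ d c : DiluteA.Site L, ∀ β ∈ DiluteA.bonds L d c,
      (∃ c' : DiluteA.Site L, DiluteA.UpperPath L d c' c ∧ DiluteA.bondLabel L d c' c = β) ∧
      (¬ (c = d ∧ DiluteA.valence L c = 2) →
        ∃! c' : DiluteA.Site L, DiluteA.UpperPath L d c' c ∧ DiluteA.bondLabel L d c' c = β)) ∧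
    -- (ii) The fused weights vanish at `u = 0`.
    (∀ a b c d : DiluteA.Site L,
      DiluteA.fusedAdj L 2 a b ≠ 0 → DiluteA.fusedAdj L 2 d c ≠ 0 →
      ∀ α ∈ DiluteA.bonds L a b, ∀ c' : DiluteA.Site L, DiluteA.UpperPath L d c' c →
        DiluteA.fusedWeight L p lam a b c d α c' 0 = 0) := by
  obtain ⟨K, h⟩ := DiluteA.exists_regime hL hp hp1 hlam hsin
  refine ⟨⟨⟨h.theta1_two_mul_ne_zero, h.theta1_three_mul_ne_zero, DiluteA.theta4_ofReal hp1,
    fun a b => ?_⟩, fun a b c d u hab hbc hcd hda hE => h.tendsto_faceWeight hab hbc hcd hda hE u⟩,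
    DiluteA.admissible_edges hL, fun d c' c hup => h.phi_ne_zero_iff_eq_bondLabel hup,
    fun d c β hβ => DiluteA.exists_upperPath hL hβ,
    fun a b c d _ _ α hα c' hup => h.fusedWeight_zero hα hup⟩
  obtain ⟨r, hr, hab⟩ := h.S_div_S a.2.1 a.2.2 b.2.1 b.2.2
  exact ⟨r, hr, h.S_ne_zero a.2.1 a.2.2, hab⟩
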